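/- Let $n\ge 1$, $Y=(-\pi,\pi)^n$, and let $a_Y\in C^1(\mathbb{R}^n,\mathbb{R}^{n\times n})$ be $Y$-periodic (that is, $2\pi$-periodic in each coordinate), symmetric, and uniformly positive definite: for some $\gamma>0$, $\sum_{i,j}(a_Y(y))_{ij}\xi_i\xi_j\ge\gamma|\xi|^2$ for all $y,\xi\in\mathbb{R}^n$. Write $\langle f\rangle_Y=\frac1{|Y|}\int_Y f\,dy$. For $k\in\mathbb{R}^n$ put $\mathcal A(k)=-(\nabla_y+\mathrm{i}k)\cdot\big(a_Y(\nabla_y+\mathrm{i}k)\,\cdot\,\big)$, acting on complex functions in $H^1_{\mathrm{per}}(Y)$ in the weak sense, and let $\mu_0(k)\in\mathbb{R}$ be its smallest eigenvalue and $\psi_0(\cdot,k)\in H^1_{\mathrm{per}}(Y)$ an eigenfunction, $\mathcal A(k)\psi_0(\cdot,k)=\mu_0(k)\psi_0(\cdot,k)$, normalized by $\langle\psi_0(\cdot,k)\rangle_Y=1$. For $k$ in a neighbourhood of $0$ the smallest eigenvalue $\mu_0(k)$ and the normalized eigenfunction $\psi_0(\cdot,k)$ exist, the latter is unique, and $k\mapsto\mu_0(k)\in\mathbb{R}$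 and $k\mapsto\psi_0(\cdot,k)\in L^2(Y)$ are real-analytic at $k=0$. For multi-indices $\alpha\in\mathbb{N}_0^n$ set $\mu_0^\alpha=\partial_k^\alpha\mu_0|_{k=0}$, $\psi_0^\alpha=\partial_k^\alpha\psi_0|_{k=0}$ (derivatives in $L^2(Y)$), and $\mathcal A^\alpha=\partial_k^\alpha\mathcal A|_{k=0}$; let $\binom\alpha\beta=\prod_i\binom{\alpha_i}{\beta_i}$, which is $0$ unless $\beta\le\alpha$, and let $e_j$ be the $j$-th unit vector. (Terms with a zero coefficient are read as $0$.) Then $\mu_0^0=0$, $\psi_0^0\equiv1$, $\langle\psi_0^\alpha\rangle_Y=0$ for $\alpha\ne0$, $\psi_0^\alpha\in H^1_{\mathrm{per}}(Y)$ for all $\alpha$, and the following hold. 1. (Cell problems.) For every $\alpha\in\mathbb{N}_0^n$, weakly in $H^1_{\mathrm{per}}(Y)$, $$\mathcal A^0\psi_0^\alpha+\sum_{j=1}^n\alpha_j\mathcal A^{e_j}\psi_0^{\alpha-e_j}+\sum_{1\le i\le j\le n}\binom{\alpha}{e_i+e_j}\mathcal A^{e_i+e_j}\psi_0^{\alpha-e_i-e_j}=\sum_{\beta\le\alpha}\binom\alpha\beta\mu_0^\beta\psi_0^{\alpha-\beta},$$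 and explicitly $$-\nabla_y\cdot[a_Y\nabla_y\psi_0^\alpha]=\mathrm{i}\sum_{j=1}^n\alpha_j\Big[(a_Y\nabla_y\psi_0^{\alpha-e_j})\cdot e_j+\nabla_y\cdot(\psi_0^{\alpha-e_j}a_Ye_j)\Big]-2\sum_{1\le i\le j\le n}\binom{\alpha}{e_i+e_j}(a_Y)_{ij}\psi_0^{\alpha-e_i-e_j}+\sum_{0\ne\beta\le\alpha}\binom\alpha\beta\mu_0^\beta\psi_0^{\alpha-\beta}.$$ For $\alpha\neq0$, $\psi_0^\alpha$ is the only weak solution $w\in H^1_{\mathrm{per}}(Y)$ of $-\nabla_y\cdot[a_Y\nabla_yw]=(\text{this right-hand side})$ with $\langle w\rangle_Y=0$. 2. (Formulas for $\mu_0^\alpha$.) If $|\alpha|$ is odd, then $\mu_0^\alpha=0$. If $|\alpha|\ge1$ is even, then $$\mu_0^\alpha=2\sum_{1\le i\le j\le n}\binom{\alpha}{e_i+e_j}\big\langle(a_Y)_{ij}\psi_0^{\alpha-e_i-e_j}\big\rangle_Y-\mathrm{i}\sum_{j=1}^n\alpha_j\big\langle a_Y\nabla_y\psi_0^{\alpha-e_j}\big\rangle_Y\cdot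 e_j.$$ 3. (The tensors $A$ and $C$.) With $A_{ij}=\frac12\mu_0^{e_i+e_j}$ and $C_{ijkl}=\frac1{24}\mu_0^{e_i+e_j+e_k+e_l}$ one has, as $k\to0$, $\mu_0(k)=\sum_{i,j} A_{ij}k_ik_j+\sum_{i,j,l,m} C_{ijlm}k_ik_jk_lk_m+O(|k|^6)$, and $$A_{ij}=\Big\langle(a_Y)_{ij}-\tfrac{\mathrm i}2\big((a_Y\nabla_y\psi_0^{e_j})\cdot e_i+(a_Y\nabla_y\psi_0^{e_i})\cdot e_j\big)\Big\rangle_Y,$$ $$\begin{aligned}C_{ijkl}=\tfrac1{24}\Big\langle&2\big((a_Y)_{ij}\psi_0^{e_k+e_l}+(a_Y)_{ik}\psi_0^{e_j+e_l}+(a_Y)_{il}\psi_0^{e_j+e_k}+(a_Y)_{jk}\psi_0^{e_i+e_l}+(a_Y)_{jl}\psi_0^{e_i+e_k}+(a_Y)_{kl}\psi_0^{e_i+e_j}\big)\\&-\mathrm i\big((a_Y\nabla_y\psi_0^{e_j+e_k+e_l})\cdot e_i+(a_Y\nabla_y\psi_0^{e_i+e_k+e_l})\cdot e_j+(a_Y\nabla_y\psi_0^{e_i+e_j+e_l})\cdot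 e_k+(a_Y\nabla_y\psi_0^{e_i+e_j+e_k})\cdot e_l\big)\Big\rangle_Y.\end{aligned}$$ -/

import Mathlib

open MeasureTheory Asymptotics Filter Topology
open scoped ContDiff ComplexConjugate

noncomputable section

namespace Bloch

/-- The periodicity cell `Y = (-π, π)ⁿ`. -/
def cell (n : ℕ) : Set (Fin n → ℝ) := Set.univ.pi fun _ => Set.Ioo (-Real.pi) Real.pi

/-- `f` is `Y`-periodic: `2π`-periodic in every coordinate. -/
def IsCellPeriodic {n : ℕ} {E : Type*} (f : (Fin n → ℝ) → E) : Prop :=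
  ∀ (y : Fin n → ℝ) (j : Fin n), f (y + Pi.single j (2 * Real.pi)) = f y

/-- The assumption on the coefficient field: `C¹`, `Y`-periodic, symmetric and uniformly
positive definite. -/
structure IsCoefficientField {n : ℕ} (a : (Fin n → ℝ) → Matrix (Fin n) (Fin n) ℝ) : Prop where
  contDiff : ∀ i j, ContDiff ℝ 1 fun y => a y i j
  periodic : IsCellPeriodic a
  symm : ∀ y i j, a y i j = a y j i
  posDef : ∃ γ : ℝ, 0 < γ ∧ ∀ (y : Fin n → ℝ) (ξ : Fin n → ℝ),
    γ * ∑ i, ξ i ^ 2 ≤ ∑ i, ∑ j, a y i j * ξ i * ξ j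

/-- The complex Hilbert space `L²(Y)`. -/
abbrev CellL2 (n : ℕ) : Type := Lp ℂ 2 (volume.restrict (cell n))

/-- `g` is the weak `j`-th partial derivative of `u`, as a periodic function: integration by parts
holds against all smooth `Y`-periodic functions (no boundary terms). -/
def HasWeakDeriv {n : ℕ} (j : Fin n) (u g : CellL2 n) : Prop :=
  ∀ φ : (Fin n → ℝ) → ℂ, ContDiff ℝ ∞ φ → IsCellPeriodic φ →
    (∫ y in cell n, u y * fderiv ℝ φ y (Pi.single j 1)) = -∫ y in cell n, g y * φ y

/-- The periodic Sobolev space `H¹_per(Y)`, as a set of `L²` functions. -/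
def H1per (n : ℕ) : Set (CellL2 n) := {u | ∀ j, ∃ g, HasWeakDeriv j u g}

open Classical in
/-- The `j`-th component of the weak gradient (zero where it does not exist). -/
def wgrad {n : ℕ} (u : CellL2 n) (j : Fin n) : CellL2 n :=
  if h : ∃ g, HasWeakDeriv j u g then h.choose else 0

/-- The pairing `∫_Y f v̄`, i.e. the function `f` tested with `v`. -/
def funPair {n : ℕ} (f : (Fin n → ℝ) → ℂ) (v : CellL2 n) : ℂ :=
  ∫ y in cell n, f y * conj (v y)

/-- The periodic distribution `∇·F` tested with `v`, i.e. `-∫_Y F · ∇v̄`. -/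
def divPair {n : ℕ} (F : (Fin n → ℝ) → Fin n → ℂ) (v : CellL2 n) : ℂ :=
  -∫ y in cell n, ∑ i, F y i * conj (wgrad v i y)

/-- The vector field `a ∇u`. -/
def flux {n : ℕ} (a : (Fin n → ℝ) → Matrix (Fin n) (Fin n) ℝ) (u : CellL2 n) :
    (Fin n → ℝ) → Fin n → ℂ :=
  fun y i => ∑ j, (a y i j : ℂ) * wgrad u j y

/-- The weak form of the operator `𝒜(k) = -(∇ + ik)·(a (∇ + ik))`: the distribution `𝒜(k) u` tested
with `v`, that is `∫_Y a (∇ + ik) u · conj ((∇ + ik) v)`. -/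
def blochForm {n : ℕ} (a : (Fin n → ℝ) → Matrix (Fin n) (Fin n) ℝ) (k : Fin n → ℝ)
    (u v : CellL2 n) : ℂ :=
  ∫ y in cell n, ∑ i, ∑ j, (a y i j : ℂ) * (wgrad u j y + Complex.I * (k j : ℂ) * u y) *
    conj (wgrad v i y + Complex.I * (k i : ℂ) * v y)

/-- `u` is an eigenfunction in `H¹_per(Y)` of `-(∇ + ik)·(a (∇ + ik) u) = μ u` (weak form). -/
def IsBlochEigenpair {n : ℕ} (a : (Fin n → ℝ) → Matrix (Fin n) (Fin n) ℝ) (k : Fin n → ℝ)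
    (μ : ℝ) (u : CellL2 n) : Prop :=
  u ∈ H1per n ∧ u ≠ 0 ∧ ∀ v ∈ H1per n, blochForm a k u v = (μ : ℂ) * funPair u v

/-- The set of Bloch eigenvalues at the wave parameter `k`. -/
def blochEigenvalues {n : ℕ} (a : (Fin n → ℝ) → Matrix (Fin n) (Fin n) ℝ) (k : Fin n → ℝ) :
    Set ℝ :=
  {μ | ∃ u, IsBlochEigenpair a k μ u}

/-- The lowest Bloch eigenvalue `μ₀(k)`. -/
def blochMu {n : ℕ} (a : (Fin n → ℝ) → Matrix (Fin n) (Fin n) ℝ) (k : Fin n → ℝ) : ℝ :=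
  sInf (blochEigenvalues a k)

/-- `u` is an eigenfunction for `μ₀(k)`, normalized to have cell average `1`. -/
def IsNormalizedBloch {n : ℕ} (a : (Fin n → ℝ) → Matrix (Fin n) (Fin n) ℝ) (k : Fin n → ℝ)
    (u : CellL2 n) : Prop :=
  IsBlochEigenpair a k (blochMu a k) u ∧ (⨍ y in cell n, u y) = 1

open Classical in
/-- The normalized Bloch eigenfunction `ψ₀(·, k)` (zero where none exists). -/
def blochPsi {n : ℕ} (a : (Fin n → ℝ) → Matrix (Fin n) (Fin n) ℝ) (k : Fin n → ℝ) : CellL2 n :=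
  if h : ∃ u, IsNormalizedBloch a k u then h.choose else 0

/-- The partial derivative `∂_j`. -/
def partialDeriv {n : ℕ} {E : Type*} [NormedAddCommGroup E] [NormedSpace ℝ E] (j : Fin n)
    (f : (Fin n → ℝ) → E) : (Fin n → ℝ) → E :=
  fun k => fderiv ℝ f k (Pi.single j 1)

/-- The differential operator `∂^α = ∂_1^{α_1} ∂_2^{α_2} ⋯ ∂_n^{α_n}`. -/
def multiDeriv {n : ℕ} {E : Type*} [NormedAddCommGroup E] [NormedSpace ℝ E] (α : Fin n → ℕ)
    (f : (Fin n → ℝ) → E) : (Fin n → ℝ) → E :=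
  (List.finRange n).foldr (fun j g => (partialDeriv j)^[α j] g) f

/-- The multi-index binomial coefficient, which vanishes unless `β ≤ α`. -/
def multiBinom {n : ℕ} (α β : Fin n → ℕ) : ℕ := ∏ i, (α i).choose (β i)

/-- The multi-index `e_j`. -/
def unitIdx {n : ℕ} (j : Fin n) : Fin n → ℕ := Pi.single j 1

/-- `μ₀^α = ∂^α μ₀` at `k = 0`. -/
def muD {n : ℕ} (a : (Fin n → ℝ) → Matrix (Fin n) (Fin n) ℝ) (α : Fin n → ℕ) : ℝ :=
  multiDeriv α (blochMu a) 0

/-- `ψ₀^α = ∂^α ψ₀` at `k = 0`, the derivatives of `k ↦ ψ₀(·, k)` being taken in `L²(Y)`. -/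
def psiD {n : ℕ} (a : (Fin n → ℝ) → Matrix (Fin n) (Fin n) ℝ) (α : Fin n → ℕ) : CellL2 n :=
  multiDeriv α (blochPsi a) 0

/-- `𝒜^α = ∂^α 𝒜` at `k = 0`, in weak form: the distribution `𝒜^α u` tested with `v`. -/
def formD {n : ℕ} (a : (Fin n → ℝ) → Matrix (Fin n) (Fin n) ℝ) (α : Fin n → ℕ)
    (u v : CellL2 n) : ℂ :=
  multiDeriv α (fun k => blochForm a k u v) 0

/-- The right-hand side of the cell problem for `ψ₀^α`, tested with `v`. It involves only `ψ₀^β`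
with `β < α` and `μ₀^β` with `β ≤ α`. Multi-index subtraction is truncated, but every term where
truncation occurs has coefficient zero. -/
def cellRhs {n : ℕ} (a : (Fin n → ℝ) → Matrix (Fin n) (Fin n) ℝ) (α : Fin n → ℕ)
    (v : CellL2 n) : ℂ :=
  Complex.I * ∑ j, (α j : ℂ) *
      (funPair (fun y => flux a (psiD a (α - unitIdx j)) y j) v
        + divPair (fun y i => psiD a (α - unitIdx j) y * (a y i j : ℂ)) v)
    - 2 * ∑ i, ∑ j ∈ Finset.Ici i, (multiBinom α (unitIdx i + unitIdx j) : ℂ) *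
        funPair (fun y => (a y i j : ℂ) * psiD a (α - unitIdx i - unitIdx j) y) v
    + ∑ β ∈ (Finset.Iic α).erase 0,
        (multiBinom α β : ℂ) * (muD a β : ℂ) * funPair (psiD a (α - β)) v

/-- `w ∈ H¹_per(Y)` is a weak solution of the cell problem `-∇·(a ∇w) = rhs` with index `α`. -/
def SolvesCellProblem {n : ℕ} (a : (Fin n → ℝ) → Matrix (Fin n) (Fin n) ℝ) (α : Fin n → ℕ)
    (w : CellL2 n) : Prop :=
  w ∈ H1per n ∧ ∀ v ∈ H1per n, -divPair (flux a w) v = cellRhs a α v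

/-- The matrix `A`: the second-order Taylor coefficients of `μ₀` at `0`. -/
def tensorA {n : ℕ} (a : (Fin n → ℝ) → Matrix (Fin n) (Fin n) ℝ) (i j : Fin n) : ℝ :=
  1 / 2 * muD a (unitIdx i + unitIdx j)

/-- The tensor `C`: the fourth-order Taylor coefficients of `μ₀` at `0`. -/
def tensorC {n : ℕ} (a : (Fin n → ℝ) → Matrix (Fin n) (Fin n) ℝ) (i j k l : Fin n) : ℝ :=
  1 / 24 * muD a (unitIdx i + unitIdx j + unitIdx k + unitIdx l)

end Bloch

end

open Bloch

/-!
The family `𝒜(k)` is treated as a family of bounded operators on the Hilbert space `H¹_per(Y)`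
(`Sobolev`), where it is a quadratic polynomial in `k` (`blochOp`), while the `L²` inner product is
represented by a fixed operator (`gramOp`). The eigenvalue problem becomes
`blochOp k ψ = μ • gramOp ψ`.

Parseval's identity on the cell (`hasSum_sq_fourierCoef`) and the fact that weak derivatives
multiply Fourier coefficients by `i m_j` give the uniqueness of weak derivatives and Poincaré's
inequality `norm_sq_le_sum_weakDeriv`. Together with ellipticity, Poincaré's inequality shows that
the linearization of the normalized eigenvalue problem at `(μ, ψ) = (0, 1)`, `k = 0`, is bijective
(`bijective_linearization`), so the analytic implicit function theorem yields an analytic branch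
`(μ(k), ψ(k))` (`exists_analytic_eigenpair`). No spectral theory is needed to see that this branch
is the bottom of the spectrum: on functions with zero average the form of `𝒜(k)` is bounded below
by `γ / 4` times the `L²` norm, whereas a combination with zero average of two eigenfunctions with
eigenvalues below `γ / 4` would have a smaller Rayleigh quotient, so all such eigenfunctions are
multiples of `ψ(k)` (`eigenpair_unique`, `exists_analytic_bloch`).

Since `𝒜(k)` is quadratic in `k`, the Leibniz rule applied to the eigenvalue equation has only
terms with at most two derivatives on `𝒜` (`multiDeriv_blochOp_apply`, `hierarchy`); unfolding the
operators into integrals gives the cell problems, which are uniquely solvable among functions with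
zero average because a function with zero energy is constant. Testing the hierarchy with the
constant `1`, on which the divergence terms vanish, gives the formulas for `μ₀^α` (`muD_eq_sum`).
Complex conjugation turns an eigenfunction at `k` into one at `-k`, so `μ₀` is even (`blochMu_neg`);
its derivatives of odd order vanish and the Taylor expansion has a remainder of order six
(`isBigO_taylor_of_even`).
-/

namespace Bloch

open scoped Pointwise

/-! ### Fourier series on the periodicity cell -/

variable {n : ℕ}

/-- The character `y ↦ exp (i m · y)` of the periodicity cell. -/
noncomputable def cellExp (m : Fin n → ℤ) (y : Fin n → ℝ) : ℂ :=
  Complex.exp (Complex.I * ∑ j, (m j : ℂ) * (y j : ℂ))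

theorem cellExp_zero (y : Fin n → ℝ) : cellExp (0 : Fin n → ℤ) y = 1 := by
  simp [cellExp]

theorem contDiff_cellExp (m : Fin n → ℤ) : ContDiff ℝ ∞ (cellExp m) := by
  unfold cellExp
  have h : ∀ j : Fin n, ContDiff ℝ ∞ fun y : Fin n → ℝ => ((y j : ℝ) : ℂ) := fun j =>
    Complex.ofRealCLM.contDiff.comp (contDiff_apply ℝ ℝ j)
  exact Complex.contDiff_exp.comp (contDiff_const.mul
    (ContDiff.sum fun j _ => contDiff_const.mul (h j)))

theorem isCellPeriodic_cellExp (m : Fin n → ℤ) : IsCellPeriodic (cellExp m) := by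
  intro y j
  have h : ∑ i, (m i : ℂ) * (((y + Pi.single j (2 * Real.pi) : Fin n → ℝ) i : ℝ) : ℂ)
      = ∑ i, (m i : ℂ) * (y i : ℂ) + (m j : ℂ) * (2 * Real.pi) := by
    simp only [Pi.add_apply, Complex.ofReal_add, mul_add, Finset.sum_add_distrib]
    congr 1
    rw [Finset.sum_eq_single j]
    · simp
    · intro i _ hi
      simp [Pi.single_eq_of_ne hi]
    · simp
  simp only [cellExp, h, mul_add, Complex.exp_add]
  rw [show Complex.I * ((m j : ℂ) * (2 * Real.pi)) = (m j : ℂ) * (2 * Real.pi * Complex.I) by ring,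
    Complex.exp_int_mul_two_pi_mul_I, mul_one]

theorem fderiv_cellExp (m : Fin n → ℤ) (y : Fin n → ℝ) (j : Fin n) :
    fderiv ℝ (cellExp m) y (Pi.single j 1) = Complex.I * (m j : ℂ) * cellExp m y := by
  have h : ∀ i : Fin n, HasFDerivAt (fun y : Fin n → ℝ => ((y i : ℝ) : ℂ))
      (Complex.ofRealCLM.comp (ContinuousLinearMap.proj i)) y := fun i =>
    (Complex.ofRealCLM.comp
      (ContinuousLinearMap.proj (R := ℝ) (φ := fun _ : Fin n => ℝ) i)).hasFDerivAt
  have h2 := ((HasFDerivAt.fun_sum (u := Finset.univ) fun i _ =>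
    (h i).const_mul (m i : ℂ)).const_mul Complex.I).cexp
  have h3 : HasFDerivAt (cellExp m) _ y := h2
  rw [h3.fderiv]
  simp only [_root_.smul_apply, _root_.sum_apply,
    ContinuousLinearMap.comp_apply, ContinuousLinearMap.proj_apply, smul_eq_mul,
    Complex.ofRealCLM_apply]
  rw [Finset.sum_eq_single (M := ℂ)
    (f := fun i => (m i : ℂ) * ((Pi.single j (1 : ℝ) : Fin n → ℝ) i : ℂ)) j]
  · simp only [cellExp, Pi.single_eq_same]; push_cast; ring
  · intro i _ hi
    simp [Pi.single_eq_of_ne hi]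
  · simp

theorem volume_cell : volume (cell n) = ENNReal.ofReal ((2 * Real.pi) ^ n) := by
  rw [cell, Real.volume_pi_Ioo]
  simp only [Finset.prod_const, Finset.card_univ, Fintype.card_fin]
  rw [ENNReal.ofReal_pow (by positivity)]
  congr 2; ring

instance isFiniteMeasure_cell : IsFiniteMeasure (volume.restrict (cell n)) :=
  ⟨by rw [Measure.restrict_apply_univ, volume_cell]; exact ENNReal.ofReal_lt_top⟩

theorem measureReal_cell : (volume.restrict (cell n)).real Set.univ = (2 * Real.pi) ^ n := by
  rw [measureReal_def, Measure.restrict_apply_univ, volume_cell,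
    ENNReal.toReal_ofReal (by positivity)]

theorem restrict_cell_eq_Icc : volume.restrict (cell n)
    = volume.restrict (Set.Icc (fun _ : Fin n => -Real.pi) fun _ => Real.pi) := by
  refine Measure.restrict_congr_set ?_
  rw [cell, ← Set.pi_univ_Icc]
  exact Measure.pi_Ioo_ae_eq_pi_Icc (f := fun _ => -Real.pi) (g := fun _ => Real.pi)

/-- The half-open unit cube centred at the origin, written in the form in which it occurs as the
fundamental domain of the unit torus. -/
def unitCube (n : ℕ) : Set (Fin n → ℝ) :=
  {x | ∀ i, x i ∈ Set.Ioc ((fun _ : Fin n => -(1 / 2 : ℝ)) i)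
    ((fun _ : Fin n => -(1 / 2 : ℝ)) i + 1)}

theorem measurableSet_unitCube : MeasurableSet (unitCube n) :=
  MeasurableSet.univ_pi' fun _ => measurableSet_Ioc

theorem smul_unitCube_ae_eq : (2 * Real.pi) • unitCube n =ᵐ[volume] cell n := by
  have hset : (2 * Real.pi) • unitCube n = Set.univ.pi fun _ => Set.Ioc (-Real.pi) Real.pi := by
    have hpi := Real.pi_pos
    ext y
    rw [Set.mem_smul_set_iff_inv_smul_mem₀ (by positivity)]
    simp only [unitCube, Set.mem_ofPred_eq, Pi.smul_apply, smul_eq_mul, Set.mem_Ioc, Set.mem_pi,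
      Set.mem_univ, true_implies]
    refine forall_congr' fun i => ?_
    rw [inv_mul_eq_div, lt_div_iff₀ (by positivity), div_le_iff₀ (by positivity)]
    constructor
    · rintro ⟨h1, h2⟩; constructor <;> linarith
    · rintro ⟨h1, h2⟩; constructor <;> linarith
  rw [hset, cell]
  exact (Measure.pi_Ioo_ae_eq_pi_Icc (f := fun _ => -Real.pi) (g := fun _ => Real.pi)).trans
    (Measure.pi_Ioc_ae_eq_pi_Icc (f := fun _ => -Real.pi) (g := fun _ => Real.pi)).symm |>.symm

theorem integral_unitCube_comp_smul {E : Type*} [NormedAddCommGroup E] [NormedSpace ℝ E]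
    (g : (Fin n → ℝ) → E) :
    ∫ x in unitCube n, g ((2 * Real.pi) • x) = ((2 * Real.pi) ^ n)⁻¹ • ∫ y in cell n, g y := by
  rw [Measure.setIntegral_comp_smul_of_pos _ _ _ (by positivity),
    setIntegral_congr_set smul_unitCube_ae_eq]
  simp only [Module.finrank_fintype_fun_eq_card, Fintype.card_fin]

theorem integrableOn_unitCube_comp_smul {E : Type*} [NormedAddCommGroup E] [NormedSpace ℝ E]
    {g : (Fin n → ℝ) → E} (hg : IntegrableOn g (cell n)) :
    IntegrableOn (fun x => g ((2 * Real.pi) • x)) (unitCube n) := by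
  have hpi : 2 * Real.pi ≠ 0 := by positivity
  rw [← integrable_indicator_iff measurableSet_unitCube]
  have h : (unitCube n).indicator (fun x => g ((2 * Real.pi) • x))
      = fun x => ((2 * Real.pi) • unitCube n).indicator g ((2 * Real.pi) • x) := by
    funext x
    by_cases hx : x ∈ unitCube n
    · rw [Set.indicator_of_mem hx, Set.indicator_of_mem (Set.smul_mem_smul_set hx)]
    · rw [Set.indicator_of_notMem hx, Set.indicator_of_notMem]
      rwa [Set.smul_mem_smul_set_iff₀ hpi]
  rw [h, integrable_comp_smul_iff _ _ hpi,
    integrable_indicator_iff (measurableSet_unitCube.const_smul₀ _)]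
  exact hg.congr_set_ae smul_unitCube_ae_eq

/-- Parseval's identity on the periodicity cell, obtained from the one on the unit torus by
rescaling. -/
theorem hasSum_sq_cellExp_coeff (u : CellL2 n) :
    HasSum (fun m : Fin n → ℤ => ‖((2 * Real.pi) ^ n)⁻¹ • ∫ y in cell n, cellExp (-m) y * u y‖ ^ 2)
      (((2 * Real.pi) ^ n)⁻¹ * ∫ y in cell n, ‖u y‖ ^ 2) := by
  have hpi := Real.pi_pos
  set b : Fin n → ℝ := fun _ => -(1 / 2 : ℝ) with hb
  -- the function on the torus with values `u (2π x)` for `x` in the half-open unit cube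
  set F : UnitAddTorus (Fin n) → ℂ := fun x =>
    u ((2 * Real.pi) • (UnitAddTorus.measurableEquivPiIoc b x).1) with hF
  have hFm : Measurable F := (Lp.stronglyMeasurable u).measurable.comp
    ((measurable_const_smul (2 * Real.pi)).comp
      (measurable_subtype_coe.comp (UnitAddTorus.measurableEquivPiIoc b).measurable))
  have hQm := measurableSet_unitCube (n := n)
  have hFQ : ∀ x ∈ unitCube n, F (fun i => (x i : UnitAddCircle)) = u ((2 * Real.pi) • x) := by
    intro x hx
    have h := (UnitAddTorus.measurableEquivPiIoc b).apply_symm_apply ⟨x, hx⟩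
    rw [UnitAddTorus.coe_symm_measurableEquivPiIoc_apply] at h
    simp only [hF]
    rw [h]
  have hu2 : Integrable (fun y => ‖u y‖ ^ 2) (volume.restrict (cell n)) :=
    (memLp_two_iff_integrable_sq_norm (Lp.aestronglyMeasurable u)).1 (Lp.memLp u)
  -- the measure for which Mathlib states Parseval's identity on the torus
  let _ : MeasureSpace UnitAddCircle := ⟨AddCircle.haarAddCircle⟩
  have hFi : ∀ g : ℂ → ℝ, Integrable (fun y => g (u y)) (volume.restrict (cell n)) →
      Integrable (fun x => g (F x)) := by
    intro g hg
    refine ((UnitAddTorus.measurePreserving_equivPiIoc b).integrable_comp_emb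
      (UnitAddTorus.measurableEquivPiIoc b).measurableEmbedding
      (g := fun q => g (u ((2 * Real.pi) • q.1)))).2 ?_
    exact (integrableOn_iff_comap_subtypeVal hQm).1 (integrableOn_unitCube_comp_smul hg)
  have hFL : MemLp F 2 (volume : Measure (UnitAddTorus (Fin n))) :=
    (memLp_two_iff_integrable_sq_norm hFm.aestronglyMeasurable).2 (hFi (fun z => ‖z‖ ^ 2) hu2)
  have hpar := UnitAddTorus.hasSum_sq_mFourierCoeff hFL.toLp
  have h1 : ∫ t, ‖hFL.toLp F t‖ ^ 2 = ((2 * Real.pi) ^ n)⁻¹ * ∫ y in cell n, ‖u y‖ ^ 2 := by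
    rw [integral_congr_ae (g := fun t => ‖F t‖ ^ 2)
      (hFL.coeFn_toLp.mono fun t ht => by simp only [ht])]
    refine (UnitAddTorus.integral_preimage (fun t => ‖F t‖ ^ 2) b).trans ?_
    rw [← smul_eq_mul, ← integral_unitCube_comp_smul (fun y => ‖u y‖ ^ 2)]
    exact setIntegral_congr_fun hQm fun x hx => by simp only [hFQ x hx]
  have h2 : ∀ m, UnitAddTorus.mFourierCoeff (hFL.toLp F) m
      = ((2 * Real.pi) ^ n)⁻¹ • ∫ y in cell n, cellExp (-m) y * u y := by
    intro m
    rw [← integral_unitCube_comp_smul (fun y => cellExp (-m) y * u y)]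
    have : UnitAddTorus.mFourierCoeff (hFL.toLp F) m = UnitAddTorus.mFourierCoeff F m :=
      integral_congr_ae (hFL.coeFn_toLp.mono fun t ht => by simp only [ht])
    rw [this, UnitAddTorus.mFourierCoeff_eq_integral F m b]
    refine setIntegral_congr_fun hQm fun x hx => ?_
    simp only [hFQ x hx, smul_eq_mul]
    congr 1
    simp only [UnitAddTorus.mFourier, ContinuousMap.coe_mk, fourier_coe_apply, cellExp,
      ← Complex.exp_sum]
    congr 1
    rw [Finset.mul_sum]
    refine Finset.sum_congr rfl fun j _ => ?_
    simp only [Pi.smul_apply, smul_eq_mul]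
    push_cast
    ring
  rw [h1] at hpar
  simpa only [h2] using hpar
end Bloch

namespace Bloch
variable {n : ℕ}

/-! ### Weak derivatives of periodic functions -/

theorem memLp_cell_of_continuous {φ : (Fin n → ℝ) → ℂ} (hφ : Continuous φ) {p : ENNReal} :
    MemLp φ p (volume.restrict (cell n)) := by
  rw [restrict_cell_eq_Icc]
  obtain ⟨C, hC⟩ := (isCompact_Icc (a := fun _ : Fin n => -Real.pi)
    (b := fun _ => Real.pi)).exists_bound_of_continuousOn hφ.continuousOn
  have : IsFiniteMeasure (volume.restrict
      (Set.Icc (fun _ : Fin n => -Real.pi) fun _ => Real.pi)) := by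
    rw [← restrict_cell_eq_Icc]; infer_instance
  exact MemLp.of_bound hφ.aestronglyMeasurable C
    ((ae_restrict_iff' measurableSet_Icc).2 (Eventually.of_forall hC))

theorem integrable_mul_cell (u : CellL2 n) {φ : (Fin n → ℝ) → ℂ} (hφ : Continuous φ) :
    Integrable (fun y => u y * φ y) (volume.restrict (cell n)) :=
  (Lp.memLp u).integrable_mul (memLp_cell_of_continuous hφ (p := 2))

theorem integrable_cell (u : CellL2 n) : Integrable (fun y => u y) (volume.restrict (cell n)) := by
  simpa using integrable_mul_cell u (continuous_const (y := (1 : ℂ)))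

/-- The linear functional `u ↦ ∫_Y u φ` on `L²(Y)` given by a continuous function `φ`. -/
noncomputable def testFunctional (φ : (Fin n → ℝ) → ℂ) (hφ : Continuous φ) : CellL2 n →L[ℂ] ℂ :=
  innerSL ℂ ((memLp_cell_of_continuous (φ := fun y => conj (φ y))
    (Complex.continuous_conj.comp hφ) (p := 2)).toLp)

theorem testFunctional_apply {φ : (Fin n → ℝ) → ℂ} (hφ : Continuous φ) (u : CellL2 n) :
    testFunctional φ hφ u = ∫ y in cell n, u y * φ y := by
  rw [testFunctional, innerSL_apply_apply, L2.inner_def]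
  refine integral_congr_ae ?_
  filter_upwards [(memLp_cell_of_continuous (φ := fun y => conj (φ y))
    (Complex.continuous_conj.comp hφ) (p := 2)).coeFn_toLp] with y hy
  rw [hy, RCLike.inner_apply, Complex.conj_conj]

theorem continuous_fderiv_apply {φ : (Fin n → ℝ) → ℂ} (hφ : ContDiff ℝ ∞ φ) (v : Fin n → ℝ) :
    Continuous fun y => fderiv ℝ φ y v :=
  (hφ.continuous_fderiv (by simp)).clm_apply continuous_const

/-- The weak derivative in terms of bounded functionals, which shows that it is a closed linear
relation. -/
theorem hasWeakDeriv_iff {j : Fin n} {u g : CellL2 n} :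
    HasWeakDeriv j u g ↔ ∀ (φ : (Fin n → ℝ) → ℂ) (hφ : ContDiff ℝ ∞ φ), IsCellPeriodic φ →
      testFunctional _ (continuous_fderiv_apply hφ (Pi.single j 1)) u
        + testFunctional φ hφ.continuous g = 0 := by
  simp only [testFunctional_apply, HasWeakDeriv, ← eq_neg_iff_add_eq_zero]

/-- The `m`-th Fourier coefficient of a function on the cell. -/
noncomputable def fourierCoef (m : Fin n → ℤ) (u : CellL2 n) : ℂ :=
  ((2 * Real.pi) ^ n)⁻¹ • ∫ y in cell n, cellExp (-m) y * u y

theorem norm_sq_eq_integral (u : CellL2 n) : ‖u‖ ^ 2 = ∫ y in cell n, ‖u y‖ ^ 2 := by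
  have h := inner_self_eq_norm_sq (𝕜 := ℂ) u
  rw [← h, L2.inner_def, ← integral_re (L2.integrable_inner u u)]
  simp only [inner_self_eq_norm_sq]

theorem hasSum_sq_fourierCoef (u : CellL2 n) :
    HasSum (fun m => ‖fourierCoef m u‖ ^ 2) (((2 * Real.pi) ^ n)⁻¹ * ‖u‖ ^ 2) := by
  rw [norm_sq_eq_integral]
  exact hasSum_sq_cellExp_coeff u

/-- Weak derivatives act on Fourier coefficients as multiplication by `i m_j`: this is the
definition of the weak derivative, tested with a character. -/
theorem fourierCoef_weakDeriv {j : Fin n} {u g : CellL2 n} (h : HasWeakDeriv j u g)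
    (m : Fin n → ℤ) : fourierCoef m g = Complex.I * (m j : ℂ) * fourierCoef m u := by
  have h1 := h _ (contDiff_cellExp (-m)) (isCellPeriodic_cellExp (-m))
  have h2 : (∫ y in cell n, u y * fderiv ℝ (cellExp (-m)) y (Pi.single j 1))
      = -(Complex.I * (m j : ℂ)) * ∫ y in cell n, cellExp (-m) y * u y := by
    rw [← integral_const_mul]
    refine integral_congr_ae (Eventually.of_forall fun y => ?_)
    simp only [fderiv_cellExp, Pi.neg_apply, Int.cast_neg]
    ring
  have h3 : ∫ y in cell n, g y * cellExp (-m) y = ∫ y in cell n, cellExp (-m) y * g y :=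
    integral_congr_ae (Eventually.of_forall fun y => mul_comm _ _)
  rw [h2, h3, neg_mul, neg_inj] at h1
  rw [fourierCoef, fourierCoef, ← h1, mul_smul_comm]

theorem eq_of_fourierCoef_eq {u v : CellL2 n} (h : ∀ m, fourierCoef m u = fourierCoef m v) :
    u = v := by
  have h0 : ∀ m, fourierCoef m (u - v) = 0 := by
    intro m
    have : ∀ w : CellL2 n, fourierCoef m w
        = ((2 * Real.pi) ^ n)⁻¹ • testFunctional _ (contDiff_cellExp (-m)).continuous w := by
      intro w
      rw [testFunctional_apply, fourierCoef]
      simp only [mul_comm]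
    rw [this, map_sub, smul_sub, ← this, ← this, h, sub_self]
  have h1 := hasSum_sq_fourierCoef (u - v)
  simp only [h0, norm_zero, ne_eq, OfNat.ofNat_ne_zero, not_false_eq_true, zero_pow] at h1
  have h2 := h1.unique hasSum_zero
  have hp : ((2 * Real.pi) ^ n)⁻¹ ≠ 0 := by positivity
  simpa [hp, sub_eq_zero] using h2

theorem HasWeakDeriv.unique {j : Fin n} {u g g' : CellL2 n} (h : HasWeakDeriv j u g)
    (h' : HasWeakDeriv j u g') : g = g' :=
  eq_of_fourierCoef_eq fun m => by rw [fourierCoef_weakDeriv h, fourierCoef_weakDeriv h']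

/-- Poincaré's inequality for periodic functions with zero average. The constant is `1` because the
smallest nonzero frequency is `1`. -/
theorem norm_sq_le_sum_weakDeriv {u : CellL2 n} {g : Fin n → CellL2 n}
    (h : ∀ j, HasWeakDeriv j u (g j)) (hu : ∫ y in cell n, u y = 0) :
    ‖u‖ ^ 2 ≤ ∑ j, ‖g j‖ ^ 2 := by
  have h1 := hasSum_sq_fourierCoef u
  have h2 := hasSum_sum (s := Finset.univ) fun j (_ : j ∈ Finset.univ) =>
    hasSum_sq_fourierCoef (g j)
  -- the inequality holds for each frequency separately
  have h3 : ∀ m : Fin n → ℤ, ‖fourierCoef m u‖ ^ 2 ≤ ∑ j, ‖fourierCoef m (g j)‖ ^ 2 := by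
    intro m
    simp only [fourierCoef_weakDeriv (h _), norm_mul, Complex.norm_I, one_mul, mul_pow,
      ← Finset.sum_mul]
    by_cases hm : m = 0
    · have : fourierCoef m u = 0 := by
        simp [hm, fourierCoef, cellExp_zero, hu]
      simp [this]
    · obtain ⟨j, hj⟩ := Function.ne_iff.1 hm
      refine le_mul_of_one_le_left (by positivity) ?_
      refine le_trans ?_ (Finset.single_le_sum (f := fun j => ‖(m j : ℂ)‖ ^ 2)
        (fun i _ => by positivity) (Finset.mem_univ j))
      have : (1 : ℝ) ≤ ‖(m j : ℂ)‖ := by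
        rw [Complex.norm_intCast]
        exact_mod_cast Int.one_le_abs hj
      exact one_le_pow₀ this
  have h4 := hasSum_le h3 h1 h2
  rw [← Finset.mul_sum] at h4
  exact le_of_mul_le_mul_left h4 (by positivity)

/-- The constant function `1` on the cell. -/
noncomputable def cellOne (n : ℕ) : CellL2 n := Lp.const 2 (volume.restrict (cell n)) (1 : ℂ)

theorem coeFn_cellOne : ∀ᵐ y ∂(volume.restrict (cell n)), cellOne n y = 1 :=
  Lp.coeFn_const ..

/-- There are no boundary terms for periodic functions. -/
theorem integral_fderiv_periodic {φ : (Fin n → ℝ) → ℂ} (hφ : ContDiff ℝ ∞ φ)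
    (hp : IsCellPeriodic φ) (j : Fin n) :
    ∫ y in cell n, fderiv ℝ φ y (Pi.single j 1) = 0 := by
  rw [restrict_cell_eq_Icc]
  -- the divergence theorem is stated in dimension `n + 1`
  obtain _ | n := n
  · exact j.elim0
  have hle : (fun _ : Fin (n + 1) => -Real.pi) ≤ fun _ => Real.pi :=
    fun _ => by have := Real.pi_pos; simp only; linarith
  have hd : ∀ y, HasFDerivAt φ (fderiv ℝ φ y) y := fun y =>
    (hφ.differentiable (by simp) y).hasFDerivAt
  have h := integral_divergence_of_hasFDerivAt_off_countable' (fun _ : Fin (n + 1) => -Real.pi)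
    (fun _ => Real.pi) hle (fun i y => if i = j then φ y else 0)
    (fun i y => if i = j then fderiv ℝ φ y else 0) ∅ Set.countable_empty
    (fun i => by split_ifs; exacts [hφ.continuous.continuousOn, continuousOn_const])
    (fun y _ i => by split_ifs; exacts [hd y, hasFDerivAt_const 0 y]) ?_
  · have h1 : ∀ y, ∑ i, (if i = j then fderiv ℝ φ y else 0) (Pi.single i 1)
        = fderiv ℝ φ y (Pi.single j 1) := by
      intro y
      rw [Finset.sum_eq_single j]
      · simp
      · intro i _ hi; simp [hi]
      · simp
    simp only [h1] at h
    rw [h]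
    refine Finset.sum_eq_zero fun i _ => ?_
    rw [sub_eq_zero]
    split_ifs with hij
    -- opposite faces differ by a period
    · refine setIntegral_congr_fun measurableSet_Icc fun x _ => ?_
      rw [← hp (i.insertNth (-Real.pi) x) i]
      congr 1
      funext l
      refine i.succAboveCases ?_ (fun l => ?_) l
      · simp; ring
      · simp
    · rfl
  · have hc : Continuous fun y => ∑ i, (if i = j then fderiv ℝ φ y else 0) (Pi.single i 1) := by
      refine continuous_finsetSum _ fun i _ => ?_
      split_ifs
      · exact continuous_fderiv_apply hφ _
      · exact continuous_const
    exact hc.continuousOn.integrableOn_compact isCompact_Icc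

theorem hasWeakDeriv_cellOne (j : Fin n) : HasWeakDeriv j (cellOne n) 0 := by
  intro φ hφ hp
  have h1 : ∫ y in cell n, cellOne n y * fderiv ℝ φ y (Pi.single j 1)
      = ∫ y in cell n, fderiv ℝ φ y (Pi.single j 1) :=
    integral_congr_ae (coeFn_cellOne.mono fun y hy => by simp only [hy, one_mul])
  have h2 : ∫ y in cell n, (0 : CellL2 n) y * φ y = 0 := by
    rw [← testFunctional_apply hφ.continuous, map_zero]
  rw [h1, h2, integral_fderiv_periodic hφ hp, neg_zero]

theorem coeFn_star_cell (u : CellL2 n) :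
    ∀ᵐ y ∂(volume.restrict (cell n)), (star u : CellL2 n) y = conj (u y) :=
  Lp.coeFn_star u

theorem HasWeakDeriv.star {j : Fin n} {u g : CellL2 n} (h : HasWeakDeriv j u g) :
    HasWeakDeriv j (star u) (star g) := by
  intro φ hφ hp
  have hφ' : ContDiff ℝ ∞ fun y => conj (φ y) :=
    Complex.conjCLE.toContinuousLinearMap.contDiff.comp hφ
  have hder : ∀ y, fderiv ℝ (fun y => conj (φ y)) y (Pi.single j 1)
      = conj (fderiv ℝ φ y (Pi.single j 1)) := by
    intro y
    have h1 : HasFDerivAt (fun y => conj (φ y))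
        (Complex.conjCLE.toContinuousLinearMap.comp (fderiv ℝ φ y)) y :=
      Complex.conjCLE.toContinuousLinearMap.hasFDerivAt.comp y
        (hφ.differentiable (by simp) y).hasFDerivAt
    rw [h1.fderiv]
    rfl
  have h1 := congrArg conj (h _ hφ' fun y i => by simp only [hp y i])
  rw [map_neg, ← integral_conj, ← integral_conj] at h1
  simp only [hder, map_mul, Complex.conj_conj] at h1
  calc _ = ∫ y in cell n, conj (u y) * fderiv ℝ φ y (Pi.single j 1) :=
        integral_congr_ae ((coeFn_star_cell u).mono fun y hy => by simp only [hy])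
    _ = _ := h1
    _ = _ := congrArg _ (integral_congr_ae ((coeFn_star_cell g).mono fun y hy => by simp only [hy]))

end Bloch

namespace Bloch
variable {n : ℕ}

/-! ### Calculus of iterated partial derivatives -/

section MultiDeriv
variable {E F : Type*} [NormedAddCommGroup E] [NormedSpace ℝ E] [NormedAddCommGroup F]
  [NormedSpace ℝ F]

/-- The derivative of `f` in the direction `v`, as a function of the point. -/
noncomputable def dirDeriv (v : Fin n → ℝ) (f : (Fin n → ℝ) → E) : (Fin n → ℝ) → E :=
  fun k => fderiv ℝ f k v

theorem partialDeriv_eq (j : Fin n) (f : (Fin n → ℝ) → E) :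
    partialDeriv j f = dirDeriv (Pi.single j 1) f := rfl

variable {f g : (Fin n → ℝ) → E} {x : Fin n → ℝ}

theorem dirDeriv_congr (v : Fin n → ℝ) (h : f =ᶠ[𝓝 x] g) :
    dirDeriv v f =ᶠ[𝓝 x] dirDeriv v g :=
  (h.fderiv (𝕜 := ℝ)).mono fun y hy => by simp only [dirDeriv, hy]

theorem dirDeriv_iterate_congr (v : Fin n → ℝ) (m : ℕ) (h : f =ᶠ[𝓝 x] g) :
    (dirDeriv v)^[m] f =ᶠ[𝓝 x] (dirDeriv v)^[m] g := by
  induction m generalizing f g with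
  | zero => exact h
  | succ m ih => exact ih (dirDeriv_congr v h)

theorem dirDeriv_eq_sum (v : Fin n → ℝ) (f : (Fin n → ℝ) → E) :
    dirDeriv v f = fun k => ∑ j, v j • partialDeriv j f k := by
  funext k
  simp only [dirDeriv, partialDeriv]
  conv_lhs => rw [pi_eq_sum_univ' v]
  simp [map_sum, map_smul]

theorem multiDeriv_zero (f : (Fin n → ℝ) → E) : multiDeriv 0 f = f := by
  have : ∀ l : List (Fin n),
      l.foldr (fun j g => (partialDeriv j)^[(0 : Fin n → ℕ) j] g) f = f := by
    intro l
    induction l with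
    | nil => rfl
    | cons i l ih => rw [List.foldr_cons, ih]; rfl
  exact this _

theorem multiDeriv_congr (α : Fin n → ℕ) (h : f =ᶠ[𝓝 x] g) :
    multiDeriv α f =ᶠ[𝓝 x] multiDeriv α g := by
  have : ∀ l : List (Fin n), l.foldr (fun j g => (partialDeriv j)^[α j] g) f
      =ᶠ[𝓝 x] l.foldr (fun j g => (partialDeriv j)^[α j] g) g := by
    intro l
    induction l with
    | nil => exact h
    | cons i l ih => exact dirDeriv_iterate_congr _ _ ih
  exact this _

variable [CompleteSpace E] [CompleteSpace F]

theorem dirDeriv_add (v : Fin n → ℝ) (hf : AnalyticAt ℝ f x) (hg : AnalyticAt ℝ g x) :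
    dirDeriv v (fun k => f k + g k) =ᶠ[𝓝 x] fun k => dirDeriv v f k + dirDeriv v g k := by
  filter_upwards [hf.eventually_analyticAt, hg.eventually_analyticAt] with y h1 h2
  simp only [dirDeriv]
  rw [fderiv_fun_add h1.differentiableAt h2.differentiableAt, add_apply]

omit [CompleteSpace F] in
theorem dirDeriv_clm (v : Fin n → ℝ) (L : E →L[ℝ] F) (hf : AnalyticAt ℝ f x) :
    dirDeriv v (fun k => L (f k)) =ᶠ[𝓝 x] fun k => L (dirDeriv v f k) := by
  filter_upwards [hf.eventually_analyticAt] with y h1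
  simp only [dirDeriv]
  have h2 : HasFDerivAt (fun k => L (f k)) (L.comp (fderiv ℝ f y)) y :=
    L.hasFDerivAt.comp y h1.differentiableAt.hasFDerivAt
  rw [h2.fderiv]
  rfl

theorem dirDeriv_smul (v : Fin n → ℝ) {c : (Fin n → ℝ) → ℝ} (hc : AnalyticAt ℝ c x)
    (hf : AnalyticAt ℝ f x) :
    dirDeriv v (fun k => c k • f k) =ᶠ[𝓝 x]
      fun k => dirDeriv v c k • f k + c k • dirDeriv v f k := by
  filter_upwards [hf.eventually_analyticAt, hc.eventually_analyticAt] with y h1 h2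
  simp only [dirDeriv]
  rw [fderiv_fun_smul h2.differentiableAt h1.differentiableAt]
  simp [add_comm]

theorem analyticAt_dirDeriv (v : Fin n → ℝ) (hf : AnalyticAt ℝ f x) :
    AnalyticAt ℝ (dirDeriv v f) x :=
  (ContinuousLinearMap.apply ℝ E v).analyticAt _ |>.comp hf.fderiv

theorem analyticAt_dirDeriv_iterate (v : Fin n → ℝ) (m : ℕ) (hf : AnalyticAt ℝ f x) :
    AnalyticAt ℝ ((dirDeriv v)^[m] f) x := by
  induction m generalizing f with
  | zero => exact hf
  | succ m ih => exact ih (analyticAt_dirDeriv v hf)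

theorem analyticAt_foldr (α : Fin n → ℕ) (hf : AnalyticAt ℝ f x) (l : List (Fin n)) :
    AnalyticAt ℝ (l.foldr (fun j g => (partialDeriv j)^[α j] g) f) x := by
  induction l with
  | nil => exact hf
  | cons i l ih => exact analyticAt_dirDeriv_iterate _ _ ih

theorem dirDeriv_comm (v w : Fin n → ℝ) (hf : AnalyticAt ℝ f x) :
    dirDeriv v (dirDeriv w f) =ᶠ[𝓝 x] dirDeriv w (dirDeriv v f) := by
  filter_upwards [hf.eventually_analyticAt] with y hy
  have h : ∀ v w : Fin n → ℝ, dirDeriv v (dirDeriv w f) y = fderiv ℝ (fderiv ℝ f) y v w := by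
    intro v w
    have h1 : HasFDerivAt (dirDeriv w f)
        ((ContinuousLinearMap.apply ℝ E w).comp (fderiv ℝ (fderiv ℝ f) y)) y :=
      (ContinuousLinearMap.apply ℝ E w).hasFDerivAt.comp y hy.fderiv.differentiableAt.hasFDerivAt
    rw [dirDeriv, h1.fderiv]
    rfl
  rw [h, h]
  exact (hy.contDiffAt (n := ω)).isSymmSndFDerivAt (by simp) v w

theorem dirDeriv_iterate_comm (v w : Fin n → ℝ) (m : ℕ) (hf : AnalyticAt ℝ f x) :
    dirDeriv v ((dirDeriv w)^[m] f) =ᶠ[𝓝 x] (dirDeriv w)^[m] (dirDeriv v f) := by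
  induction m generalizing f with
  | zero => rfl
  | succ m ih =>
    exact (ih (analyticAt_dirDeriv w hf)).trans
      (dirDeriv_iterate_congr _ _ (dirDeriv_comm v w hf))

theorem dirDeriv_foldr_comm (v : Fin n → ℝ) (α : Fin n → ℕ) (hf : AnalyticAt ℝ f x)
    (l : List (Fin n)) :
    dirDeriv v (l.foldr (fun j g => (partialDeriv j)^[α j] g) f)
      =ᶠ[𝓝 x] l.foldr (fun j g => (partialDeriv j)^[α j] g) (dirDeriv v f) := by
  induction l with
  | nil => rfl
  | cons i l ih =>
    exact (dirDeriv_iterate_comm v _ (α i) (analyticAt_foldr α hf l)).trans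
      (dirDeriv_iterate_congr _ _ ih)

/-- A partial derivative can be moved into a mixed derivative of an analytic function. -/
theorem multiDeriv_add_unitIdx (α : Fin n → ℕ) (j : Fin n) (hf : AnalyticAt ℝ f x) :
    multiDeriv (α + unitIdx j) f =ᶠ[𝓝 x] multiDeriv α (partialDeriv j f) := by
  have hnot : ∀ l : List (Fin n), j ∉ l →
      l.foldr (fun i g => (partialDeriv i)^[(α + unitIdx j) i] g) f
        = l.foldr (fun i g => (partialDeriv i)^[α i] g) f := by
    intro l hl
    induction l with
    | nil => rfl
    | cons i l ih =>
      rw [List.mem_cons, not_or] at hl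
      rw [List.foldr_cons, List.foldr_cons, ih hl.2]
      have : (α + unitIdx j) i = α i := by simp [unitIdx, Pi.single_eq_of_ne (Ne.symm hl.1)]
      rw [this]
  have hmem : ∀ l : List (Fin n), l.Nodup → j ∈ l →
      l.foldr (fun i g => (partialDeriv i)^[(α + unitIdx j) i] g) f
        =ᶠ[𝓝 x] l.foldr (fun i g => (partialDeriv i)^[α i] g) (partialDeriv j f) := by
    intro l hl hj
    induction l with
    | nil => simp at hj
    | cons i l ih =>
      rw [List.nodup_cons] at hl
      rw [List.foldr_cons, List.foldr_cons]
      by_cases hij : i = j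
      · subst hij
        rw [hnot l hl.1, show (α + unitIdx i) i = α i + 1 by simp [unitIdx],
          Function.iterate_succ_apply]
        exact dirDeriv_iterate_congr _ _ (dirDeriv_foldr_comm _ α hf l)
      · have h1 : (α + unitIdx j) i = α i := by simp [unitIdx, Pi.single_eq_of_ne hij]
        rw [h1]
        exact dirDeriv_iterate_congr _ _ (ih hl.2 ((List.mem_cons.1 hj).resolve_left (Ne.symm hij)))
  exact hmem _ (List.nodup_finRange n) (List.mem_finRange j)

theorem multiIdx_induction {P : (Fin n → ℕ) → Prop} (h0 : P 0)
    (hs : ∀ α j, P α → P (α + unitIdx j)) (α : Fin n → ℕ) : P α := by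
  induction hN : ∑ i, α i generalizing α with
  | zero =>
    have : α = 0 := by
      funext i
      exact (Finset.sum_eq_zero_iff.1 hN) i (Finset.mem_univ i)
    exact this ▸ h0
  | succ N ih =>
    obtain ⟨j, -, hj⟩ : ∃ j ∈ Finset.univ, α j ≠ 0 := by
      refine Finset.exists_ne_zero_of_sum_ne_zero (s := Finset.univ) (f := α) ?_
      omega
    have h1 : α = (α - unitIdx j) + unitIdx j := by
      funext i
      by_cases hi : i = j
      · subst hi; simp [unitIdx]; omega
      · simp [unitIdx, Pi.single_eq_of_ne hi]
    rw [h1]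
    refine hs _ _ (ih _ ?_)
    have h2 : ∑ i, α i = ∑ i, (α - unitIdx j) i + 1 := by
      conv_lhs => rw [h1]
      simp [Finset.sum_add_distrib, unitIdx]
    omega

theorem multiDeriv_add (α : Fin n → ℕ) (hf : AnalyticAt ℝ f x) (hg : AnalyticAt ℝ g x) :
    multiDeriv α (fun k => f k + g k) =ᶠ[𝓝 x] fun k => multiDeriv α f k + multiDeriv α g k := by
  induction α using multiIdx_induction generalizing f g with
  | h0 => simp only [multiDeriv_zero]; rfl
  | hs α j ih =>
    filter_upwards [multiDeriv_add_unitIdx α j (hf.fun_add hg), multiDeriv_add_unitIdx α j hf,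
      multiDeriv_add_unitIdx α j hg, multiDeriv_congr α (dirDeriv_add (Pi.single j 1) hf hg),
      ih (analyticAt_dirDeriv (Pi.single j 1) hf) (analyticAt_dirDeriv (Pi.single j 1) hg)]
      with y h1 h2 h3 h4 h5
    rw [h1, h2, h3, partialDeriv_eq, h4, h5]
    rfl

theorem multiDeriv_clm (α : Fin n → ℕ) (L : E →L[ℝ] F) (hf : AnalyticAt ℝ f x) :
    multiDeriv α (fun k => L (f k)) =ᶠ[𝓝 x] fun k => L (multiDeriv α f k) := by
  induction α using multiIdx_induction generalizing f with
  | h0 => simp only [multiDeriv_zero]; rfl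
  | hs α j ih =>
    filter_upwards [multiDeriv_add_unitIdx α j ((L.analyticAt _).comp hf),
      multiDeriv_add_unitIdx α j hf, multiDeriv_congr α (dirDeriv_clm (Pi.single j 1) L hf),
      ih (analyticAt_dirDeriv (Pi.single j 1) hf)] with y h1 h2 h3 h4
    rw [h2]
    refine h1.trans (h3.trans (h4.trans rfl))

theorem multiDeriv_fun_zero (α : Fin n → ℕ) :
    multiDeriv α (fun _ : Fin n → ℝ => (0 : E)) x = 0 := by
  simpa using (multiDeriv_clm (f := fun _ => (0 : E)) (x := x) α (0 : E →L[ℝ] E)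
    analyticAt_const).self_of_nhds

theorem multiDeriv_sum {ι : Type*} (s : Finset ι) (α : Fin n → ℕ) {f : ι → (Fin n → ℝ) → E}
    (hf : ∀ i ∈ s, AnalyticAt ℝ (f i) x) :
    multiDeriv α (fun k => ∑ i ∈ s, f i k) x = ∑ i ∈ s, multiDeriv α (f i) x := by
  classical
  induction s using Finset.induction_on with
  | empty => simpa using multiDeriv_fun_zero α
  | insert i s hi ih =>
    simp only [Finset.sum_insert hi]
    rw [(multiDeriv_add α (hf i (by simp)) (Finset.analyticAt_fun_sum s fun j hj =>
      hf j (by simp [hj]))).self_of_nhds]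
    beta_reduce
    rw [ih fun j hj => hf j (by simp [hj])]

theorem analyticAt_coord (j : Fin n) : AnalyticAt ℝ (fun k : Fin n → ℝ => k j) x :=
  (ContinuousLinearMap.proj (R := ℝ) (φ := fun _ : Fin n => ℝ) j).analyticAt x

theorem dirDeriv_coord (v : Fin n → ℝ) (j : Fin n) :
    dirDeriv v (fun k : Fin n → ℝ => k j) = fun _ => v j := by
  funext y
  have h : HasFDerivAt (fun k : Fin n → ℝ => k j) _ y :=
    (ContinuousLinearMap.proj (R := ℝ) (φ := fun _ : Fin n => ℝ) j).hasFDerivAt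
  rw [dirDeriv, h.fderiv]
  rfl

/-- The Leibniz rule when one of the factors is a coordinate function. -/
theorem multiDeriv_coord_smul (α : Fin n → ℕ) (i : Fin n) (hf : AnalyticAt ℝ f x) :
    multiDeriv α (fun k => k i • f k) =ᶠ[𝓝 x]
      fun k => k i • multiDeriv α f k + (α i : ℝ) • multiDeriv (α - unitIdx i) f k := by
  induction α using multiIdx_induction generalizing f with
  | h0 => simp [multiDeriv_zero]
  | hs α j ih =>
    have hj := analyticAt_dirDeriv (Pi.single j 1) hf
    have hc : AnalyticAt ℝ (fun k => (Pi.single j (1 : ℝ) : Fin n → ℝ) i • f k) x :=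
      analyticAt_const.fun_smul hf
    filter_upwards [multiDeriv_add_unitIdx α j ((analyticAt_coord i).fun_smul hf),
      multiDeriv_congr α (dirDeriv_smul (Pi.single j 1) (analyticAt_coord i) hf),
      multiDeriv_add α hc ((analyticAt_coord i).fun_smul hj), ih hj,
      multiDeriv_clm α ((Pi.single j (1 : ℝ) : Fin n → ℝ) i • ContinuousLinearMap.id ℝ E) hf,
      multiDeriv_add_unitIdx α j hf, multiDeriv_add_unitIdx (α - unitIdx i) j hf]
      with y h1 h2 h3 h4 h5 h6 h7
    simp only [_root_.smul_apply, ContinuousLinearMap.id_apply] at h5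
    rw [dirDeriv_coord] at h2
    rw [h1, partialDeriv_eq, h2, h3, h4, h5, h6, ← partialDeriv_eq, ← h7]
    by_cases hij : i = j
    · subst hij
      have e1 : α + unitIdx i - unitIdx i = α := by simp
      rw [e1]
      simp only [Pi.single_eq_same, Pi.add_apply, unitIdx]
      by_cases h0 : α i = 0
      · simp [h0, add_comm]
      · have e2 : α - Pi.single i 1 + Pi.single i 1 = α := by
          funext l
          by_cases hl : l = i
          · subst hl; simp; omega
          · simp [Pi.single_eq_of_ne hl]
        rw [e2]
        push_cast
        module
    · have e1 : α + unitIdx j - unitIdx i = α - unitIdx i + unitIdx j := by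
        funext l
        by_cases hl : l = i
        · subst hl; simp [unitIdx, Pi.single_eq_of_ne hij]
        · simp [unitIdx, Pi.single_eq_of_ne hl]
      rw [e1]
      simp [unitIdx, Pi.single_eq_of_ne hij]

theorem multiDeriv_coord_smul_zero (α : Fin n → ℕ) (i : Fin n) (hf : AnalyticAt ℝ f 0) :
    multiDeriv α (fun k => k i • f k) 0 = (α i : ℝ) • multiDeriv (α - unitIdx i) f 0 := by
  simpa using (multiDeriv_coord_smul α i hf).self_of_nhds

theorem multiBinom_eq_zero {α β : Fin n → ℕ} (h : ¬ β ≤ α) : multiBinom α β = 0 := by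
  rw [Pi.le_def, not_forall] at h
  obtain ⟨i, hi⟩ := h
  exact Finset.prod_eq_zero (Finset.mem_univ i) (Nat.choose_eq_zero_of_lt (not_le.1 hi))

theorem multiBinom_zero_right (α : Fin n → ℕ) : multiBinom α 0 = 1 := by
  simp [multiBinom]

theorem multiBinom_self (α : Fin n → ℕ) : multiBinom α α = 1 := by
  simp [multiBinom]

/-- Pascal's rule. -/
theorem multiBinom_add_unitIdx (α β : Fin n → ℕ) (j : Fin n) :
    multiBinom (α + unitIdx j) (β + unitIdx j)
      = multiBinom α β + multiBinom α (β + unitIdx j) := by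
  have h : ∀ γ δ : Fin n → ℕ, multiBinom γ δ
      = (γ j).choose (δ j) * ∏ i ∈ Finset.univ.erase j, (γ i).choose (δ i) := fun γ δ =>
    (Finset.mul_prod_erase _ _ (Finset.mem_univ j)).symm
  have h2 : ∀ γ : Fin n → ℕ, ∀ i ∈ Finset.univ.erase j, (γ + unitIdx j) i = γ i := by
    intro γ i hi
    simp [unitIdx, Pi.single_eq_of_ne (Finset.ne_of_mem_erase hi)]
  rw [h, h α β, h α (β + unitIdx j)]
  rw [Finset.prod_congr rfl fun i hi => by rw [h2 α i hi, h2 β i hi],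
    Finset.prod_congr (s₁ := Finset.univ.erase j) (f := fun i => (α i).choose ((β + unitIdx j) i))
      rfl fun i hi => by rw [h2 β i hi], ← add_mul]
  congr 1
  simp [unitIdx, Nat.choose_succ_succ]

theorem multiBinom_add_unitIdx_of_eq_zero (α β : Fin n → ℕ) (j : Fin n) (hj : β j = 0) :
    multiBinom (α + unitIdx j) β = multiBinom α β := by
  refine Finset.prod_congr rfl fun i _ => ?_
  by_cases hi : i = j
  · subst hi; simp [hj]
  · simp [unitIdx, Pi.single_eq_of_ne hi]

/-- The combinatorial identity behind the Leibniz rule. -/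
theorem sum_multiBinom_add_unitIdx {M : Type*} [AddCommMonoid M] (α : Fin n → ℕ) (j : Fin n)
    (h : (Fin n → ℕ) → M) :
    ∑ β ∈ Finset.Iic (α + unitIdx j), multiBinom (α + unitIdx j) β • h β
      = ∑ β ∈ Finset.Iic α, multiBinom α β • (h (β + unitIdx j) + h β) := by
  classical
  have hsub : Finset.Iic α ⊆ Finset.Iic (α + unitIdx j) := by
    intro β hβ
    rw [Finset.mem_Iic] at hβ ⊢
    exact hβ.trans (by simp)
  have hext : ∑ β ∈ Finset.Iic α, multiBinom α β • h β
      = ∑ β ∈ Finset.Iic (α + unitIdx j), multiBinom α β • h β := by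
    refine Finset.sum_subset hsub fun β _ hβ => ?_
    rw [multiBinom_eq_zero (by rwa [Finset.mem_Iic] at hβ), zero_smul]
  simp only [smul_add, Finset.sum_add_distrib]
  rw [hext]
  rw [← Finset.sum_filter_add_sum_filter_not (Finset.Iic (α + unitIdx j)) (fun β => 1 ≤ β j)
    (fun β => multiBinom (α + unitIdx j) β • h β)]
  rw [← Finset.sum_filter_add_sum_filter_not (Finset.Iic (α + unitIdx j)) (fun β => 1 ≤ β j)
    (fun β => multiBinom α β • h β), ← add_assoc]
  have himg : (Finset.Iic (α + unitIdx j)).filter (fun β => 1 ≤ β j)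
      = (Finset.Iic α).map (addRightEmbedding (unitIdx j)) := by
    ext β
    simp only [Finset.mem_filter, Finset.mem_Iic, Finset.mem_map, addRightEmbedding_apply]
    constructor
    · rintro ⟨h1, h2⟩
      have e : β - unitIdx j + unitIdx j = β := by
        funext l
        by_cases hl : l = j
        · subst hl; simp [unitIdx]; omega
        · simp [unitIdx, Pi.single_eq_of_ne hl]
      refine ⟨β - unitIdx j, ?_, e⟩
      rw [← e] at h1
      exact le_of_add_le_add_right h1
    · rintro ⟨γ, h1, rfl⟩
      exact ⟨add_le_add_left h1 _, by simp [unitIdx]⟩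
  congr 1
  · rw [himg]
    simp only [Finset.sum_map, addRightEmbedding_apply, multiBinom_add_unitIdx, add_smul,
      Finset.sum_add_distrib]
  · refine Finset.sum_congr rfl fun β hβ => ?_
    rw [multiBinom_add_unitIdx_of_eq_zero]
    have := (Finset.mem_filter.1 hβ).2
    omega

/-- The Leibniz rule. -/
theorem multiDeriv_smul (α : Fin n → ℕ) {c : (Fin n → ℝ) → ℝ} (hc : AnalyticAt ℝ c x)
    (hf : AnalyticAt ℝ f x) :
    multiDeriv α (fun k => c k • f k) =ᶠ[𝓝 x] fun k => ∑ β ∈ Finset.Iic α,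
      multiBinom α β • (multiDeriv β c k • multiDeriv (α - β) f k) := by
  induction α using multiIdx_induction generalizing c f with
  | h0 =>
    refine Eventually.of_forall fun k => ?_
    have : Finset.Iic (0 : Fin n → ℕ) = {0} := by
      ext β; simp
    simp [this, multiDeriv_zero, multiBinom_zero_right]
  | hs α j ih =>
    have hcj := analyticAt_dirDeriv (Pi.single j 1) hc
    have hfj := analyticAt_dirDeriv (Pi.single j 1) hf
    have hc' : ∀ᶠ y in 𝓝 x, ∀ β ∈ Finset.Iic α, multiDeriv (β + unitIdx j) c y
        = multiDeriv β (dirDeriv (Pi.single j 1) c) y :=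
      (Finset.eventually_all _).2 fun β _ => multiDeriv_add_unitIdx β j hc
    have hf' : ∀ᶠ y in 𝓝 x, ∀ β ∈ Finset.Iic α, multiDeriv (α - β + unitIdx j) f y
        = multiDeriv (α - β) (dirDeriv (Pi.single j 1) f) y :=
      (Finset.eventually_all _).2 fun β _ => multiDeriv_add_unitIdx (α - β) j hf
    filter_upwards [multiDeriv_add_unitIdx α j (hc.fun_smul hf),
      multiDeriv_congr α (dirDeriv_smul (Pi.single j 1) hc hf),
      multiDeriv_add α (hcj.fun_smul hf) (hc.fun_smul hfj), ih hcj hf, ih hc hfj, hc', hf']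
      with y h1 h2 h3 h4 h5 h6 h7
    rw [h1, partialDeriv_eq, h2, h3, h4, h5,
      sum_multiBinom_add_unitIdx α j
        (fun β => multiDeriv β c y • multiDeriv (α + unitIdx j - β) f y),
      ← Finset.sum_add_distrib]
    refine Finset.sum_congr rfl fun β hβ => ?_
    have e1 : α + unitIdx j - (β + unitIdx j) = α - β := add_tsub_add_eq_tsub_right _ _ _
    have e2 : α + unitIdx j - β = α - β + unitIdx j :=
      (tsub_add_eq_add_tsub (Finset.mem_Iic.1 hβ)).symm
    rw [e1, e2, h6 β hβ, h7 β hβ, smul_add]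

/-- A reflection multiplies the derivatives of order `m` at `0` by `(-1) ^ m`; in particular the
derivatives of odd order of an even function vanish. -/
theorem multiDeriv_comp_neg (α : Fin n → ℕ) (hf : AnalyticAt ℝ f 0) :
    multiDeriv α (fun k => f (-k)) 0 = (-1 : ℝ) ^ (∑ i, α i) • multiDeriv α f 0 := by
  have hneg : ∀ {f : (Fin n → ℝ) → E}, AnalyticAt ℝ f 0 → AnalyticAt ℝ (fun k => f (-k)) 0 := by
    intro f hf
    have h0 : AnalyticAt ℝ f (-(0 : Fin n → ℝ)) := by rwa [neg_zero]
    exact h0.fun_comp (analyticAt_id.fun_neg)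
  induction α using multiIdx_induction generalizing f with
  | h0 => simp [multiDeriv_zero]
  | hs α j ih =>
    have hj := analyticAt_dirDeriv (Pi.single j 1) hf
    have hd : partialDeriv j (fun k => f (-k))
        = fun k => (-ContinuousLinearMap.id ℝ E) (dirDeriv (Pi.single j 1) f (-k)) := by
      funext k
      have h1 := fderiv_comp_smul (𝕜 := ℝ) (f := f) (-1 : ℝ) (x := k)
      simp only [neg_smul, one_smul] at h1
      simp [partialDeriv, dirDeriv, h1]
    rw [(multiDeriv_add_unitIdx α j (hneg hf)).self_of_nhds, hd,
      (multiDeriv_clm α _ (hneg hj)).self_of_nhds]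
    beta_reduce
    rw [ih hj,
      (multiDeriv_add_unitIdx α j hf).self_of_nhds, partialDeriv_eq]
    have : ∑ i, (α + unitIdx j) i = ∑ i, α i + 1 := by
      simp [Finset.sum_add_distrib, unitIdx]
    rw [this, pow_succ]
    simp

/-! ### Taylor expansion of even functions -/

/-- The diagonal values of the iterated Fréchet derivative are iterated directional derivatives. -/
theorem iteratedFDeriv_const_eq (v : Fin n → ℝ) (m : ℕ) (hf : AnalyticAt ℝ f x) :
    (fun y => iteratedFDeriv ℝ m f y fun _ => v) =ᶠ[𝓝 x] (dirDeriv v)^[m] f := by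
  induction m with
  | zero => exact Eventually.of_forall fun y => by simp
  | succ m ih =>
    rw [Function.iterate_succ_apply']
    refine EventuallyEq.trans ?_ (dirDeriv_congr v ih)
    filter_upwards [hf.eventually_analyticAt] with y hy
    rw [iteratedFDeriv_succ_apply_left]
    have h1 : DifferentiableAt ℝ (iteratedFDeriv ℝ m f) y :=
      (hy.contDiffAt (n := ω)).differentiableAt_iteratedFDeriv (by simp)
    have h2 : HasFDerivAt (fun y => iteratedFDeriv ℝ m f y fun _ => v) _ y :=
      (ContinuousMultilinearMap.apply ℝ (fun _ : Fin m => Fin n → ℝ) E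
        (fun _ => v)).hasFDerivAt.comp y h1.hasFDerivAt
    rw [dirDeriv, h2.fderiv]
    rfl

theorem dirDeriv_iterate_add (v : Fin n → ℝ) (m : ℕ) (hf : AnalyticAt ℝ f x)
    (hg : AnalyticAt ℝ g x) :
    (dirDeriv v)^[m] (fun k => f k + g k) =ᶠ[𝓝 x]
      fun k => (dirDeriv v)^[m] f k + (dirDeriv v)^[m] g k := by
  induction m generalizing f g with
  | zero => rfl
  | succ m ih =>
    exact (dirDeriv_iterate_congr v m (dirDeriv_add v hf hg)).trans
      (ih (analyticAt_dirDeriv v hf) (analyticAt_dirDeriv v hg))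

omit [CompleteSpace F] in
theorem dirDeriv_iterate_clm (v : Fin n → ℝ) (m : ℕ) (L : E →L[ℝ] F) (hf : AnalyticAt ℝ f x) :
    (dirDeriv v)^[m] (fun k => L (f k)) =ᶠ[𝓝 x] fun k => L ((dirDeriv v)^[m] f k) := by
  induction m generalizing f with
  | zero => rfl
  | succ m ih =>
    exact (dirDeriv_iterate_congr v m (dirDeriv_clm v L hf)).trans (ih (analyticAt_dirDeriv v hf))

theorem dirDeriv_iterate_succ_eq_sum (v : Fin n → ℝ) (m : ℕ) (hf : AnalyticAt ℝ f x) :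
    (dirDeriv v)^[m + 1] f x = ∑ j, v j • (dirDeriv v)^[m] (partialDeriv j f) x := by
  classical
  rw [Function.iterate_succ_apply, dirDeriv_eq_sum]
  have hj : ∀ j, AnalyticAt ℝ (fun k => v j • partialDeriv j f k) x := fun j =>
    analyticAt_const.fun_smul (analyticAt_dirDeriv _ hf)
  have h : ∀ s : Finset (Fin n), (dirDeriv v)^[m] (fun k => ∑ j ∈ s, v j • partialDeriv j f k) x
      = ∑ j ∈ s, v j • (dirDeriv v)^[m] (partialDeriv j f) x := by
    intro s
    induction s using Finset.induction_on with
    | empty =>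
      simpa using (dirDeriv_iterate_clm (f := fun _ => (0 : E)) (x := x) v m (0 : E →L[ℝ] E)
        analyticAt_const).self_of_nhds
    | insert i s hi ih =>
      simp only [Finset.sum_insert hi]
      rw [(dirDeriv_iterate_add v m (hj i)
        (Finset.analyticAt_fun_sum s fun j _ => hj j)).self_of_nhds]
      beta_reduce
      rw [ih]
      congr 1
      simpa [partialDeriv_eq] using (dirDeriv_iterate_clm v m (v i • ContinuousLinearMap.id ℝ E)
        (analyticAt_dirDeriv (Pi.single i 1) hf)).self_of_nhds
  exact h _

/-- A directional derivative of order `m` is a combination of the mixed partial derivatives of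
order `m`. -/
theorem dirDeriv_iterate_eq_zero (v : Fin n → ℝ) (m : ℕ) (hf : AnalyticAt ℝ f x)
    (h : ∀ α : Fin n → ℕ, ∑ i, α i = m → multiDeriv α f x = 0) : (dirDeriv v)^[m] f x = 0 := by
  induction m generalizing f with
  | zero => simpa [multiDeriv_zero] using h 0 (by simp)
  | succ m ih =>
    rw [dirDeriv_iterate_succ_eq_sum v m hf]
    refine Finset.sum_eq_zero fun j _ => ?_
    rw [partialDeriv_eq, ih (analyticAt_dirDeriv _ hf), smul_zero]
    intro α hα
    rw [← partialDeriv_eq]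
    rw [← (multiDeriv_add_unitIdx α j hf).self_of_nhds]
    exact h _ (by simp [Finset.sum_add_distrib, unitIdx, hα])

theorem multiDeriv_two (hf : AnalyticAt ℝ f x) (i j : Fin n) :
    multiDeriv (unitIdx i + unitIdx j) f x = partialDeriv i (partialDeriv j f) x := by
  have hj : AnalyticAt ℝ (partialDeriv j f) x := analyticAt_dirDeriv _ hf
  rw [(multiDeriv_add_unitIdx _ j hf).self_of_nhds, ← zero_add (unitIdx i),
    (multiDeriv_add_unitIdx _ i hj).self_of_nhds, multiDeriv_zero]

/-- An analytic function that vanishes at `0` together with its derivatives of odd order agrees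
with its Taylor polynomial of degree `4` up to an error of order six. -/
theorem isBigO_taylor_of_even {f : (Fin n → ℝ) → ℝ} (hf : AnalyticAt ℝ f 0) (h0 : f 0 = 0)
    (hodd : ∀ α : Fin n → ℕ, Odd (∑ i, α i) → multiDeriv α f 0 = 0) :
    (fun k : Fin n → ℝ => f k
        - (∑ i, ∑ j, (1 / 2 * multiDeriv (unitIdx i + unitIdx j) f 0) * k i * k j
          + ∑ i, ∑ j, ∑ l, ∑ m, (1 / 24 *
            multiDeriv (unitIdx i + unitIdx j + unitIdx l + unitIdx m) f 0)
              * k i * k j * k l * k m))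
      =O[𝓝 0] fun k : Fin n → ℝ => (∑ i, k i ^ 2) ^ 3 := by
  obtain ⟨p, hp⟩ := hf
  have hf : AnalyticAt ℝ f 0 := ⟨p, hp⟩
  have h1 := hp.isBigO_sub_partialSum_pow 6
  -- the homogeneous terms of the power series are directional derivatives
  have hd : ∀ m k, (m.factorial : ℝ) * p m (fun _ => k) = (dirDeriv k)^[m] f 0 := by
    intro m k
    obtain ⟨r, hr⟩ := hp
    have := hr.factorial_smul k m
    rw [nsmul_eq_mul] at this
    rw [this]
    exact (iteratedFDeriv_const_eq k m hf).self_of_nhds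
  have ho : ∀ m k, Odd m → p m (fun _ => k) = 0 := by
    intro m k hm
    have h := hd m k
    rw [dirDeriv_iterate_eq_zero k m hf fun α hα => hodd α (hα ▸ hm)] at h
    exact (mul_eq_zero.1 h).resolve_left (by positivity)
  have h2 : ∀ k, p 2 (fun _ => k)
      = ∑ i, ∑ j, (1 / 2 * multiDeriv (unitIdx i + unitIdx j) f 0) * k i * k j := by
    intro k
    have h := hd 2 k
    rw [dirDeriv_iterate_succ_eq_sum k 1 hf] at h
    have e : 1 / 2 * ∑ i, k i • (dirDeriv k)^[1] (partialDeriv i f) 0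
        = ∑ i, ∑ j, (1 / 2 * multiDeriv (unitIdx i + unitIdx j) f 0) * k i * k j := by
      rw [Finset.mul_sum]
      refine Finset.sum_congr rfl fun i _ => ?_
      have hi : AnalyticAt ℝ (partialDeriv i f) 0 := analyticAt_dirDeriv _ hf
      rw [dirDeriv_iterate_succ_eq_sum k 0 hi]
      simp only [Finset.mul_sum, smul_eq_mul, Function.iterate_zero, id]
      refine Finset.sum_congr rfl fun j _ => ?_
      rw [add_comm (unitIdx i), multiDeriv_two hf]
      ring
    rw [← e, ← h, Nat.factorial_two, Nat.cast_ofNat, ← mul_assoc]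
    norm_num
  have h4 : ∀ k, p 4 (fun _ => k)
      = ∑ i, ∑ j, ∑ l, ∑ m, (1 / 24 *
            multiDeriv (unitIdx i + unitIdx j + unitIdx l + unitIdx m) f 0)
              * k i * k j * k l * k m := by
    intro k
    have h := hd 4 k
    rw [dirDeriv_iterate_succ_eq_sum k 3 hf] at h
    have e : 1 / 24 * ∑ i, k i • (dirDeriv k)^[3] (partialDeriv i f) 0
      = ∑ i, ∑ j, ∑ l, ∑ m, (1 / 24 *
            multiDeriv (unitIdx i + unitIdx j + unitIdx l + unitIdx m) f 0)
              * k i * k j * k l * k m := by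
      rw [Finset.mul_sum]
      refine Finset.sum_congr rfl fun i _ => ?_
      have hi : AnalyticAt ℝ (partialDeriv i f) 0 := analyticAt_dirDeriv _ hf
      rw [dirDeriv_iterate_succ_eq_sum k 2 hi]
      simp only [Finset.mul_sum, smul_eq_mul]
      refine Finset.sum_congr rfl fun j _ => ?_
      have hj : AnalyticAt ℝ (partialDeriv j (partialDeriv i f)) 0 := analyticAt_dirDeriv _ hi
      rw [dirDeriv_iterate_succ_eq_sum k 1 hj]
      simp only [Finset.mul_sum, smul_eq_mul]
      refine Finset.sum_congr rfl fun l _ => ?_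
      have hl : AnalyticAt ℝ (partialDeriv l (partialDeriv j (partialDeriv i f))) 0 :=
        analyticAt_dirDeriv _ hj
      rw [dirDeriv_iterate_succ_eq_sum k 0 hl]
      simp only [Finset.mul_sum, smul_eq_mul, Function.iterate_zero, id]
      refine Finset.sum_congr rfl fun m _ => ?_
      rw [show unitIdx i + unitIdx j + unitIdx l + unitIdx m
          = unitIdx m + unitIdx l + unitIdx j + unitIdx i by abel,
        (multiDeriv_add_unitIdx _ i hf).self_of_nhds,
        (multiDeriv_add_unitIdx _ j hi).self_of_nhds, multiDeriv_two hj]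
      ring
    rw [← e, ← h, show Nat.factorial 4 = 24 from rfl, Nat.cast_ofNat, ← mul_assoc]
    norm_num
  refine (h1.congr_left fun k => ?_).trans ?_
  · rw [zero_add, FormalMultilinearSeries.partialSum]
    simp only [Finset.sum_range_succ, Finset.sum_range_zero]
    rw [ho 1 k (by decide), ho 3 k (by decide), ho 5 k (by decide), h2, h4]
    have : p 0 (fun _ => k) = 0 := by
      rw [← h0]; exact hp.coeff_zero _
    rw [this]
    ring
  · refine IsBigO.of_bound 1 (Eventually.of_forall fun k => ?_)
    -- `‖k‖` is the maximum norm
    have hk : ‖k‖ ^ 2 ≤ ∑ i, k i ^ 2 := by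
      have hs : 0 ≤ ∑ i, k i ^ 2 := Finset.sum_nonneg fun i _ => sq_nonneg _
      rw [← Real.le_sqrt (norm_nonneg _) hs]
      refine (pi_norm_le_iff_of_nonneg (Real.sqrt_nonneg _)).2 fun i => ?_
      rw [Real.le_sqrt (norm_nonneg _) hs, Real.norm_eq_abs, sq_abs]
      exact Finset.single_le_sum (f := fun i => k i ^ 2) (fun i _ => sq_nonneg _)
        (Finset.mem_univ i)
    rw [one_mul, norm_pow, norm_norm, Real.norm_of_nonneg (by positivity)]
    calc ‖k‖ ^ 6 = (‖k‖ ^ 2) ^ 3 := by ring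
      _ ≤ _ := by gcongr

end MultiDeriv
end Bloch

namespace Bloch

/-! ### Analytic perturbation of a simple eigenvalue -/

section Abstract
variable {V : Type*} [NormedAddCommGroup V] [InnerProductSpace ℂ V] [CompleteSpace V]

/-- The Lax–Milgram theorem over `ℂ`: a coercive bounded operator is surjective. -/
theorem surjective_of_coercive (K : V →L[ℂ] V) {c : ℝ} (hc : 0 < c)
    (h : ∀ v, c * ‖v‖ ^ 2 ≤ (inner ℂ v (K v)).re) : Function.Surjective K := by
  have hb : ∀ v, ‖v‖ ≤ c⁻¹ * ‖K v‖ := by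
    intro v
    by_cases hv : v = 0
    · simp [hv]
    have h1 : c * ‖v‖ ^ 2 ≤ ‖v‖ * ‖K v‖ :=
      (h v).trans ((Complex.re_le_norm _).trans (norm_inner_le_norm _ _))
    have hv' : 0 < ‖v‖ := norm_pos_iff.2 hv
    rw [inv_mul_eq_div, le_div_iff₀ hc]
    nlinarith
  have hanti : AntilipschitzWith (c⁻¹).toNNReal K :=
    ContinuousLinearMap.antilipschitz_of_bound K fun v => by
      rw [Real.coe_toNNReal _ (inv_nonneg.2 hc.le)]; exact hb v
  have hcl : IsClosed (K.range : Set V) := hanti.isClosed_range K.uniformContinuous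
  suffices h : K.range = ⊤ from LinearMap.range_eq_top.1 h
  have := hcl.completeSpace_coe
  rw [← K.range.orthogonal_orthogonal, Submodule.eq_top_iff']
  intro v w hw
  have h0 : inner ℂ w (K w) = 0 := by
    have h1 : inner ℂ (K w) w = 0 := hw _ ⟨w, rfl⟩
    rw [← inner_conj_symm, h1, map_zero]
  have h1 := h w
  rw [h0, Complex.zero_re] at h1
  have h2 : ‖w‖ ^ 2 = 0 := le_antisymm (by nlinarith [sq_nonneg ‖w‖]) (sq_nonneg _)
  have h3 : w = 0 := by simpa using h2
  rw [h3, inner_zero_left]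

variable [NormedSpace ℝ V] [IsScalarTower ℝ ℂ V]

/-- Analytic continuation of a normalized eigenpair of an analytic operator pencil
`T k ψ = μ • S ψ`, `ℓ ψ = 1`, when the linearization at the base point is bijective. -/
theorem exists_analytic_eigenpair {K : Type*} [NormedAddCommGroup K] [NormedSpace ℝ K]
    [CompleteSpace K] {T : K → V →L[ℂ] V} {k₀ : K} (hT : AnalyticAt ℝ T k₀) (S : V →L[ℂ] V)
    (ℓ : V →L[ℂ] ℂ) (e : V) (h0 : T k₀ e = 0) (he : ℓ e = 1)
    (hbij : Function.Bijective fun p : ℂ × V => (ℓ p.2, T k₀ p.2 - p.1 • S e)) :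
    ∃ (μ : K → ℂ) (ψ : K → V), AnalyticAt ℝ μ k₀ ∧ AnalyticAt ℝ ψ k₀ ∧ μ k₀ = 0 ∧ ψ k₀ = e ∧
      ∀ᶠ k in 𝓝 k₀, T k (ψ k) = μ k • S (ψ k) ∧ ℓ (ψ k) = 1 := by
  -- the implicit function theorem, applied to `Φ (k, μ, v) = (1, 0)`
  let Φ : K × (ℂ × V) → ℂ × V := fun q => (ℓ q.2.2, T q.1 q.2.2 - q.2.1 • S q.2.2)
  let u : K × (ℂ × V) := (k₀, (0, e))
  have hΦu : Φ u = (1, 0) := by simp [Φ, u, h0, he]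
  have hf2 : AnalyticAt ℝ (fun q : K × (ℂ × V) => q.2.2) u :=
    AnalyticAt.comp (g := Prod.snd) analyticAt_snd analyticAt_snd
  have hf1 : AnalyticAt ℝ (fun q : K × (ℂ × V) => q.2.1) u :=
    AnalyticAt.comp (g := Prod.fst) analyticAt_fst analyticAt_snd
  have hℓ : AnalyticAt ℝ (fun q : K × (ℂ × V) => ℓ q.2.2) u :=
    ((ℓ.restrictScalars ℝ).analyticAt _).comp hf2
  have hS : AnalyticAt ℝ (fun q : K × (ℂ × V) => S q.2.2) u :=
    ((S.restrictScalars ℝ).analyticAt _).comp hf2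
  have hT' : AnalyticAt ℝ (fun q : K × (ℂ × V) => T q.1) u :=
    AnalyticAt.comp (g := T) (f := Prod.fst) hT analyticAt_fst
  have hTv : AnalyticAt ℝ (fun q : K × (ℂ × V) => T q.1 q.2.2) u := by
    have h1 : AnalyticAt ℝ (fun q : K × (ℂ × V) => (T q.1).restrictScalars ℝ) u :=
      AnalyticAt.comp (g := fun A => ContinuousLinearMap.restrictScalarsL ℂ V V ℝ ℝ A)
        (ContinuousLinearMap.analyticAt _ _) hT'
    exact AnalyticAt.comp (g := fun p : (V →L[ℝ] V) × V => p.1 p.2)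
      ((ContinuousLinearMap.id ℝ (V →L[ℝ] V)).analyticAt_bilinear _) (h1.prod hf2)
  have hΦ : AnalyticAt ℝ Φ u := hℓ.prod (hTv.sub (hf1.smul hS))
  have hcd : ContDiffAt ℝ ω Φ u := hΦ.contDiffAt
  -- the partial derivative of `Φ` in the unknowns `(μ, v)`
  let D : ℂ × V →L[ℝ] ℂ × V :=
    ((ℓ.restrictScalars ℝ).comp (ContinuousLinearMap.snd ℝ ℂ V)).prod
      (((T k₀).restrictScalars ℝ).comp (ContinuousLinearMap.snd ℝ ℂ V)
        - (ContinuousLinearMap.fst ℝ ℂ V).smulRight (S e))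
  have hD : fderiv ℝ Φ u ∘L .inr ℝ K (ℂ × V) = D := by
    have h1 : HasFDerivAt (fun y : ℂ × V => Φ (k₀, y)) (fderiv ℝ Φ u ∘L .inr ℝ K (ℂ × V)) (0, e) :=
      HasFDerivAt.comp (g := Φ) (f := fun y : ℂ × V => (k₀, y)) (0, e)
        hΦ.differentiableAt.hasFDerivAt (hasFDerivAt_prodMk_right k₀ (0, e))
    have hs2 : HasFDerivAt (fun y : ℂ × V => S y.2)
        ((S.restrictScalars ℝ).comp (ContinuousLinearMap.snd ℝ ℂ V)) (0, e) :=
      ((S.restrictScalars ℝ).comp (ContinuousLinearMap.snd ℝ ℂ V)).hasFDerivAt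
    have h2 : HasFDerivAt (fun y : ℂ × V => Φ (k₀, y)) _ (0, e) :=
      (((ℓ.restrictScalars ℝ).comp (ContinuousLinearMap.snd ℝ ℂ V)).hasFDerivAt).prodMk
        ((((T k₀).restrictScalars ℝ).comp (ContinuousLinearMap.snd ℝ ℂ V)).hasFDerivAt.sub
          ((hasFDerivAt_fst (𝕜 := ℝ) (p := ((0 : ℂ), e))).fun_smul hs2))
    rw [h1.unique h2]
    ext <;> simp [D]
  have hinv : (fderiv ℝ Φ u ∘L .inr ℝ K (ℂ × V)).IsInvertible := by
    rw [hD]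
    have hb : Function.Bijective D := hbij
    refine ⟨ContinuousLinearEquiv.ofBijective D (LinearMap.ker_eq_bot.2 hb.1)
      (LinearMap.range_eq_top.2 hb.2), ?_⟩
    ext <;> rfl
  have hω : (ω : WithTop ℕ∞) ≠ 0 := by simp
  let s := hcd.implicitFunction hω hinv
  have hs : AnalyticAt ℝ s k₀ := (hcd.contDiffAt_implicitFunction hω hinv).analyticAt
  have hs0 : s k₀ = (0, e) := hcd.implicitFunction_apply_self hω hinv
  refine ⟨fun k => (s k).1, fun k => (s k).2, analyticAt_fst.comp hs, analyticAt_snd.comp hs,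
    by simp [hs0], by simp [hs0], ?_⟩
  filter_upwards [hcd.eventually_apply_implicitFunction hω hinv] with k hk
  rw [hΦu] at hk
  simp only [Φ, Prod.mk.injEq] at hk
  exact ⟨sub_eq_zero.1 hk.2, hk.1⟩

end Abstract
end Bloch

namespace Bloch
variable {n : ℕ}

/-! ### The periodic Sobolev space as a Hilbert space -/

/-- The space `H¹_per(Y)`, encoded as the tuples consisting of a function (at index `none`) and its
weak partial derivatives (at the indices `some j`); as such it inherits a Hilbert space norm. -/
noncomputable def sobolevSubmodule (n : ℕ) :
    Submodule ℂ (PiLp 2 fun _ : Option (Fin n) => CellL2 n) where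
  carrier := {U | ∀ j, HasWeakDeriv j (U none) (U (some j))}
  add_mem' {U W} hU hW j := by
    have h1 := hasWeakDeriv_iff.1 (hU j)
    have h2 := hasWeakDeriv_iff.1 (hW j)
    refine hasWeakDeriv_iff.2 fun φ hφ hp => ?_
    simp only [PiLp.add_apply, map_add]
    linear_combination h1 φ hφ hp + h2 φ hφ hp
  zero_mem' j := hasWeakDeriv_iff.2 fun φ hφ hp => by simp
  smul_mem' c U hU j := by
    have h1 := hasWeakDeriv_iff.1 (hU j)
    refine hasWeakDeriv_iff.2 fun φ hφ hp => ?_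
    simp only [PiLp.smul_apply, map_smul, smul_eq_mul]
    linear_combination c * h1 φ hφ hp

theorem mem_sobolevSubmodule {U : PiLp 2 fun _ : Option (Fin n) => CellL2 n} :
    U ∈ sobolevSubmodule n ↔ ∀ j, HasWeakDeriv j (U none) (U (some j)) := Iff.rfl

theorem isClosed_sobolevSubmodule :
    IsClosed (sobolevSubmodule n : Set (PiLp 2 fun _ : Option (Fin n) => CellL2 n)) := by
  have h : (sobolevSubmodule n : Set (PiLp 2 fun _ : Option (Fin n) => CellL2 n))
      = ⋂ (j : Fin n) (φ : (Fin n → ℝ) → ℂ) (hφ : ContDiff ℝ ∞ φ) (_ : IsCellPeriodic φ),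
        {U | testFunctional _ (continuous_fderiv_apply hφ (Pi.single j 1)) (U none)
          + testFunctional φ hφ.continuous (U (some j)) = 0} := by
    ext U
    simp only [SetLike.mem_coe, mem_sobolevSubmodule, hasWeakDeriv_iff, Set.mem_iInter,
      Set.mem_ofPred_eq]
  rw [h]
  refine isClosed_iInter fun j => isClosed_iInter fun φ => isClosed_iInter fun hφ =>
    isClosed_iInter fun _ => isClosed_eq ?_ continuous_const
  have hproj : ∀ o, Continuous fun U : PiLp 2 fun _ : Option (Fin n) => CellL2 n => U o :=
    fun o => (PiLp.proj (𝕜 := ℂ) 2 (fun _ : Option (Fin n) => CellL2 n) o).continuous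
  exact ((testFunctional _ _).continuous.comp (hproj none)).add
    ((testFunctional _ _).continuous.comp (hproj (some j)))

/-- The Hilbert space `H¹_per(Y)`. -/
def Sobolev (n : ℕ) : Type := sobolevSubmodule n

noncomputable instance instNormedAddCommGroupSobolev : NormedAddCommGroup (Sobolev n) :=
  inferInstanceAs (NormedAddCommGroup (sobolevSubmodule n))

noncomputable instance instInnerProductSpaceSobolev : InnerProductSpace ℂ (Sobolev n) :=
  inferInstanceAs (InnerProductSpace ℂ (sobolevSubmodule n))

instance instCompleteSpaceSobolev : CompleteSpace (Sobolev n) :=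
  isClosed_sobolevSubmodule.completeSpace_coe

/-- The embedding of `H¹_per(Y)` into `L²(Y)`. -/
noncomputable def toL2 : Sobolev n →L[ℂ] CellL2 n :=
  (PiLp.proj 2 (fun _ : Option (Fin n) => CellL2 n) none).comp (sobolevSubmodule n).subtypeL

/-- The weak partial derivative as a bounded operator from `H¹_per(Y)` to `L²(Y)`. -/
noncomputable def weakPartial (j : Fin n) : Sobolev n →L[ℂ] CellL2 n :=
  (PiLp.proj 2 (fun _ : Option (Fin n) => CellL2 n) (some j)).comp (sobolevSubmodule n).subtypeL

theorem hasWeakDeriv_toL2 (U : Sobolev n) (j : Fin n) :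
    HasWeakDeriv j (toL2 U) (weakPartial j U) := U.2 j

theorem toL2_mem_H1per (U : Sobolev n) : toL2 U ∈ H1per n :=
  fun j => ⟨_, hasWeakDeriv_toL2 U j⟩

theorem wgrad_toL2 (U : Sobolev n) (j : Fin n) : wgrad (toL2 U) j = weakPartial j U := by
  have h : ∃ g, HasWeakDeriv j (toL2 U) g := ⟨_, hasWeakDeriv_toL2 U j⟩
  rw [wgrad, dif_pos h]
  exact h.choose_spec.unique (hasWeakDeriv_toL2 U j)

/-- Assemble an element of `H¹_per(Y)` from a function and its weak partial derivatives. -/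
noncomputable def sobolevMk (u : CellL2 n) (g : Fin n → CellL2 n)
    (h : ∀ j, HasWeakDeriv j u (g j)) : Sobolev n :=
  ⟨WithLp.toLp 2 fun o => o.elim u g, h⟩

theorem toL2_mk {u : CellL2 n} {g : Fin n → CellL2 n} (h : ∀ j, HasWeakDeriv j u (g j)) :
    toL2 (sobolevMk u g h) = u := rfl

theorem exists_toL2_eq {u : CellL2 n} (hu : u ∈ H1per n) : ∃ U : Sobolev n, toL2 U = u := by
  choose g hg using hu
  exact ⟨sobolevMk u g hg, toL2_mk hg⟩

theorem norm_sq_sobolev (U : Sobolev n) : ‖U‖ ^ 2 = ‖toL2 U‖ ^ 2 + ∑ j, ‖weakPartial j U‖ ^ 2 := by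
  have h := PiLp.norm_sq_eq_of_L2 _ U.1
  rw [Fintype.sum_option] at h
  exact h

theorem toL2_injective : Function.Injective (toL2 (n := n)) := by
  rw [injective_iff_map_eq_zero]
  intro U hU
  have h : ∀ j, weakPartial j U = 0 := fun j => by
    refine (hasWeakDeriv_toL2 U j).unique ?_
    rw [hU]
    exact hasWeakDeriv_iff.2 fun φ hφ hp => by simp
  have := norm_sq_sobolev U
  simpa [h, hU] using this

/-- The constant function `1` as an element of `H¹_per(Y)`. -/
noncomputable def sobolevOne (n : ℕ) : Sobolev n :=
  sobolevMk (cellOne n) (fun _ => 0) hasWeakDeriv_cellOne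

theorem toL2_one : toL2 (sobolevOne n) = cellOne n := rfl

theorem weakPartial_one (j : Fin n) : weakPartial j (sobolevOne n) = 0 := rfl

/-- The cell average on `L²(Y)`. -/
noncomputable def average (n : ℕ) : CellL2 n →L[ℂ] ℂ :=
  (((2 * Real.pi) ^ n : ℝ) : ℂ)⁻¹ • testFunctional (fun _ => 1) continuous_const

theorem setAverage_cell (f : (Fin n → ℝ) → ℂ) :
    ⨍ y in cell n, f y = (((2 * Real.pi) ^ n : ℝ) : ℂ)⁻¹ * ∫ y in cell n, f y := by
  rw [MeasureTheory.average_eq, measureReal_cell, Complex.real_smul, Complex.ofReal_inv]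

theorem average_eq_setAverage (u : CellL2 n) : average n u = ⨍ y in cell n, u y := by
  rw [setAverage_cell, average, _root_.smul_apply, testFunctional_apply, smul_eq_mul]
  simp only [mul_one]

theorem cellVolume_ne_zero : (((2 * Real.pi) ^ n : ℝ) : ℂ) ≠ 0 := by
  rw [Complex.ofReal_ne_zero]; positivity

theorem inner_cell (u v : CellL2 n) : inner ℂ u v = ∫ y in cell n, v y * conj (u y) := by
  rw [L2.inner_def]
  simp only [RCLike.inner_apply]

theorem inner_cellOne (u : CellL2 n) :
    inner ℂ (cellOne n) u = (((2 * Real.pi) ^ n : ℝ) : ℂ) * average n u := by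
  rw [average_eq_setAverage, setAverage_cell, ← mul_assoc, mul_inv_cancel₀ cellVolume_ne_zero,
    one_mul, inner_cell]
  exact integral_congr_ae (coeFn_cellOne.mono fun y hy => by simp only [hy, map_one, mul_one])

theorem average_cellOne : average n (cellOne n) = 1 := by
  rw [average_eq_setAverage, setAverage_cell, integral_congr_ae coeFn_cellOne]
  simp only [integral_const, measureReal_cell, Complex.real_smul, mul_one]
  exact inv_mul_cancel₀ cellVolume_ne_zero

theorem norm_sq_cellOne : ‖cellOne n‖ ^ 2 = (2 * Real.pi) ^ n := by
  have h := inner_cellOne (cellOne n)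
  rw [average_cellOne, mul_one, inner_self_eq_norm_sq_to_K] at h
  exact Complex.ofReal_injective (by simpa using h)

theorem norm_toL2_sq_le_of_average_eq_zero {U : Sobolev n} (h : average n (toL2 U) = 0) :
    ‖toL2 U‖ ^ 2 ≤ ∑ j, ‖weakPartial j U‖ ^ 2 := by
  refine norm_sq_le_sum_weakDeriv (hasWeakDeriv_toL2 U) ?_
  rw [average_eq_setAverage, setAverage_cell] at h
  exact (mul_eq_zero.1 h).resolve_left (inv_ne_zero cellVolume_ne_zero)

/-! ### The Bloch operators -/

/-- Multiplication by a continuous function, as an operator on `L²(Y)`. -/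
noncomputable def mulOp (c : (Fin n → ℝ) → ℂ) (hc : Continuous c) : CellL2 n →L[ℂ] CellL2 n :=
  (ContinuousLinearMap.mul ℂ ℂ).holderL (volume.restrict (cell n)) ⊤ 2 2
    ((memLp_cell_of_continuous hc).toLp)

theorem coeFn_mulOp {c : (Fin n → ℝ) → ℂ} (hc : Continuous c) (u : CellL2 n) :
    ∀ᵐ y ∂(volume.restrict (cell n)), mulOp c hc u y = c y * u y := by
  filter_upwards [(ContinuousLinearMap.mul ℂ ℂ).coeFn_holder (r := 2)
    ((memLp_cell_of_continuous hc (p := ⊤)).toLp) u,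
    (memLp_cell_of_continuous hc (p := ⊤)).coeFn_toLp] with y h1 h2
  exact h1.trans (by rw [h2]; rfl)

variable {a : (Fin n → ℝ) → Matrix (Fin n) (Fin n) ℝ} (ha : IsCoefficientField a)
include ha

theorem IsCoefficientField.continuous (i j : Fin n) : Continuous fun y => (a y i j : ℂ) :=
  Complex.continuous_ofReal.comp (ha.contDiff i j).continuous

omit ha in
/-- Multiplication by the coefficient `a_{ij}`. -/
noncomputable def coefOp (ha : IsCoefficientField a) (i j : Fin n) : CellL2 n →L[ℂ] CellL2 n :=
  mulOp (fun y => (a y i j : ℂ)) (ha.continuous i j)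

theorem inner_coefOp (i j : Fin n) (u v : CellL2 n) :
    inner ℂ u (coefOp ha i j v) = ∫ y in cell n, (a y i j : ℂ) * v y * conj (u y) := by
  rw [inner_cell]
  exact integral_congr_ae ((coeFn_mulOp (ha.continuous i j) v).mono fun y hy => by
    simp only [coefOp, hy])

theorem integrable_coef_mul (i j : Fin n) (u v : CellL2 n) :
    Integrable (fun y => (a y i j : ℂ) * v y * conj (u y)) (volume.restrict (cell n)) := by
  refine (L2.integrable_inner u (coefOp ha i j v)).congr ?_
  exact (coeFn_mulOp (ha.continuous i j) v).mono fun y hy => by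
    simp only [coefOp, hy, RCLike.inner_apply]

theorem coefOp_comm (i j : Fin n) : coefOp ha i j = coefOp ha j i := by
  unfold coefOp
  congr 1
  funext y
  rw [ha.symm]

theorem inner_coefOp_left (i j : Fin n) (u v : CellL2 n) :
    inner ℂ (coefOp ha i j u) v = inner ℂ u (coefOp ha i j v) := by
  rw [← inner_conj_symm, inner_coefOp, inner_coefOp, ← integral_conj]
  refine integral_congr_ae (Eventually.of_forall fun y => ?_)
  simp only [map_mul, Complex.conj_ofReal, Complex.conj_conj]
  ring

/-- Uniform ellipticity, integrated over the cell. -/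
theorem le_re_sum_inner_coefOp {γ : ℝ} (hγ : ∀ (y : Fin n → ℝ) (ξ : Fin n → ℝ),
    γ * ∑ i, ξ i ^ 2 ≤ ∑ i, ∑ j, a y i j * ξ i * ξ j) (x : Fin n → CellL2 n) :
    γ * ∑ j, ‖x j‖ ^ 2 ≤ (∑ i, ∑ j, inner ℂ (x i) (coefOp ha i j (x j))).re := by
  have hint : ∀ i j, Integrable (fun y => (a y i j : ℂ) * x j y * conj (x i y))
      (volume.restrict (cell n)) := fun i j => integrable_coef_mul ha i j (x i) (x j)
  have hsum : (∑ i, ∑ j, inner ℂ (x i) (coefOp ha i j (x j)))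
      = ∫ y in cell n, ∑ i, ∑ j, (a y i j : ℂ) * x j y * conj (x i y) := by
    rw [integral_finsetSum _ fun i _ => integrable_finsetSum _ fun j _ => hint i j]
    refine Finset.sum_congr rfl fun i _ => ?_
    rw [integral_finsetSum _ fun j _ => hint i j]
    exact Finset.sum_congr rfl fun j _ => inner_coefOp ha i j _ _
  have hre : (∫ y in cell n, ∑ i, ∑ j, (a y i j : ℂ) * x j y * conj (x i y)).re
      = ∫ y in cell n, (∑ i, ∑ j, (a y i j : ℂ) * x j y * conj (x i y)).re :=
    (integral_re (integrable_finsetSum _ fun i _ => integrable_finsetSum _ fun j _ =>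
      hint i j)).symm
  have hsq : ∀ j, Integrable (fun y => ‖x j y‖ ^ 2) (volume.restrict (cell n)) := fun j =>
    (memLp_two_iff_integrable_sq_norm (Lp.aestronglyMeasurable (x j))).1 (Lp.memLp (x j))
  rw [hsum, hre]
  simp only [norm_sq_eq_integral]
  rw [← integral_finsetSum _ fun j _ => hsq j, ← integral_const_mul]
  refine integral_mono ((integrable_finsetSum _ fun j _ => hsq j).const_mul γ)
    (integrable_finsetSum _ fun i _ => integrable_finsetSum _ fun j _ => hint i j).re fun y => ?_
  -- for a real symmetric matrix the form splits into real and imaginary parts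
  have h1 := hγ y fun i => (x i y).re
  have h2 := hγ y fun i => (x i y).im
  have h3 : ∀ i j, ((a y i j : ℂ) * x j y * conj (x i y)).re
      = a y i j * (x i y).re * (x j y).re + a y i j * (x i y).im * (x j y).im := by
    intro i j
    simp [Complex.mul_re, Complex.mul_im]
    ring
  simp only [Complex.re_sum, h3, Finset.sum_add_distrib]
  have h4 : ∀ i, ‖x i y‖ ^ 2 = (x i y).re ^ 2 + (x i y).im ^ 2 := fun i => by
    rw [← Complex.normSq_eq_norm_sq, Complex.normSq_apply]; ring
  simp only [h4, Finset.sum_add_distrib, mul_add]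
  exact add_le_add h1 h2

omit ha in
/-- The `j`-th component of `∇ + ik`. -/
noncomputable def blochPartial (k : Fin n → ℝ) (j : Fin n) : Sobolev n →L[ℂ] CellL2 n :=
  weakPartial j + (Complex.I * (k j : ℂ)) • toL2

omit ha in
/-- The part of `𝒜(k)` that does not depend on `k`, as an operator on `H¹_per(Y)`. -/
noncomputable def blochOp₀ (ha : IsCoefficientField a) : Sobolev n →L[ℂ] Sobolev n :=
  ∑ i, ∑ j, (weakPartial i).adjoint ∘L coefOp ha i j ∘L weakPartial j

omit ha in
/-- The coefficient of `k_j` in `𝒜(k)`. -/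
noncomputable def blochOp₁ (ha : IsCoefficientField a) (j : Fin n) : Sobolev n →L[ℂ] Sobolev n :=
  Complex.I • ∑ i, ((weakPartial i).adjoint ∘L coefOp ha i j ∘L toL2
    - toL2.adjoint ∘L coefOp ha j i ∘L weakPartial i)

omit ha in
/-- The coefficient of `k_i k_j` in `𝒜(k)`. -/
noncomputable def blochOp₂ (ha : IsCoefficientField a) (i j : Fin n) : Sobolev n →L[ℂ] Sobolev n :=
  toL2.adjoint ∘L coefOp ha i j ∘L toL2

omit ha in
/-- The operator on `H¹_per(Y)` representing the sesquilinear form of `𝒜(k)`. -/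
noncomputable def blochOp (ha : IsCoefficientField a) (k : Fin n → ℝ) :
    Sobolev n →L[ℂ] Sobolev n :=
  blochOp₀ ha + ∑ j, k j • blochOp₁ ha j + ∑ i, ∑ j, k i • k j • blochOp₂ ha i j

omit ha in
/-- The operator on `H¹_per(Y)` representing the `L²` inner product. -/
noncomputable def gramOp (n : ℕ) : Sobolev n →L[ℂ] Sobolev n := toL2.adjoint ∘L toL2

omit ha in
theorem inner_gramOp (U W : Sobolev n) :
    inner ℂ W (gramOp n U) = inner ℂ (toL2 W) (toL2 U) := by
  rw [gramOp, ContinuousLinearMap.comp_apply, ContinuousLinearMap.adjoint_inner_right]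

theorem inner_blochOp₀ (U W : Sobolev n) : inner ℂ W (blochOp₀ ha U)
    = ∑ i, ∑ j, inner ℂ (weakPartial i W) (coefOp ha i j (weakPartial j U)) := by
  simp only [blochOp₀, _root_.sum_apply, inner_sum, ContinuousLinearMap.comp_apply,
    ContinuousLinearMap.adjoint_inner_right]

theorem inner_blochOp₁ (j : Fin n) (U W : Sobolev n) : inner ℂ W (blochOp₁ ha j U)
    = Complex.I * ∑ i, (inner ℂ (weakPartial i W) (coefOp ha i j (toL2 U))
      - inner ℂ (toL2 W) (coefOp ha j i (weakPartial i U))) := by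
  simp only [blochOp₁, _root_.sum_apply, _root_.smul_apply, _root_.sub_apply, inner_sum,
    inner_sub_right, inner_smul_right, ContinuousLinearMap.comp_apply,
    ContinuousLinearMap.adjoint_inner_right]

theorem inner_blochOp₂ (i j : Fin n) (U W : Sobolev n) :
    inner ℂ W (blochOp₂ ha i j U) = inner ℂ (toL2 W) (coefOp ha i j (toL2 U)) := by
  simp only [blochOp₂, ContinuousLinearMap.comp_apply, ContinuousLinearMap.adjoint_inner_right]

theorem inner_blochOp_eq_add (k : Fin n → ℝ) (U W : Sobolev n) : inner ℂ W (blochOp ha k U)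
    = inner ℂ W (blochOp₀ ha U) + ∑ j, k j • inner ℂ W (blochOp₁ ha j U)
      + ∑ i, ∑ j, k i • k j • inner ℂ W (blochOp₂ ha i j U) := by
  simp only [blochOp, _root_.add_apply, _root_.sum_apply, _root_.smul_apply, inner_add_right,
    inner_sum, inner_smul_right_eq_smul]

theorem inner_blochOp (k : Fin n → ℝ) (U W : Sobolev n) : inner ℂ W (blochOp ha k U)
    = ∑ i, ∑ j, inner ℂ (blochPartial k i W) (coefOp ha i j (blochPartial k j U)) := by
  have h : ∀ i j, inner ℂ (blochPartial k i W) (coefOp ha i j (blochPartial k j U))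
      = inner ℂ (weakPartial i W) (coefOp ha i j (weakPartial j U))
        + (Complex.I * (k j * inner ℂ (weakPartial i W) (coefOp ha i j (toL2 U)))
        - Complex.I * (k i * inner ℂ (toL2 W) (coefOp ha i j (weakPartial j U))))
        + k i * (k j * inner ℂ (toL2 W) (coefOp ha i j (toL2 U))) := by
    intro i j
    simp only [blochPartial, _root_.add_apply, _root_.smul_apply, map_add, map_smul,
      inner_add_left, inner_add_right, inner_smul_left, inner_smul_right, map_mul, Complex.conj_I,
      Complex.conj_ofReal]
    linear_combination (-(k i : ℂ) * k j * inner ℂ (toL2 W) (coefOp ha i j (toL2 U)))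
      * Complex.I_mul_I
  rw [inner_blochOp_eq_add, inner_blochOp₀]
  simp only [h, Finset.sum_add_distrib, Finset.sum_sub_distrib, inner_blochOp₁, inner_blochOp₂,
    Complex.real_smul, mul_sub, Finset.mul_sum]
  congr 2
  congr 1
  · rw [Finset.sum_comm]
    exact Finset.sum_congr rfl fun i _ => Finset.sum_congr rfl fun j _ => by ring
  · exact Finset.sum_congr rfl fun i _ => Finset.sum_congr rfl fun j _ => by ring

theorem blochForm_toL2 (k : Fin n → ℝ) (U W : Sobolev n) :
    blochForm a k (toL2 U) (toL2 W) = inner ℂ W (blochOp ha k U) := by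
  have hD : ∀ (U : Sobolev n) (j : Fin n), ∀ᵐ y ∂(volume.restrict (cell n)), blochPartial k j U y
      = weakPartial j U y + Complex.I * (k j : ℂ) * toL2 U y := by
    intro U j
    filter_upwards [Lp.coeFn_add (weakPartial j U) ((Complex.I * (k j : ℂ)) • toL2 U),
      Lp.coeFn_smul (Complex.I * (k j : ℂ)) (toL2 U)] with y h1 h2
    rw [blochPartial, _root_.add_apply, _root_.smul_apply, h1, Pi.add_apply, h2]
    rfl
  have hint := fun i j => integrable_coef_mul ha i j (blochPartial k i W) (blochPartial k j U)
  rw [inner_blochOp]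
  have h1 : ∑ i, ∑ j, inner ℂ (blochPartial k i W) (coefOp ha i j (blochPartial k j U))
      = ∫ y in cell n, ∑ i, ∑ j, (a y i j : ℂ) * blochPartial k j U y
          * conj (blochPartial k i W y) := by
    rw [integral_finsetSum _ fun i _ => integrable_finsetSum _ fun j _ => hint i j]
    refine Finset.sum_congr rfl fun i _ => ?_
    rw [integral_finsetSum _ fun j _ => hint i j]
    exact Finset.sum_congr rfl fun j _ => inner_coefOp ha i j _ _
  rw [h1, blochForm]
  refine integral_congr_ae ?_
  filter_upwards [ae_all_iff.2 (hD U), ae_all_iff.2 (hD W)] with y hU hW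
  simp only [hU, hW, wgrad_toL2]

omit ha in
theorem funPair_toL2 (U W : Sobolev n) :
    funPair (toL2 U) (toL2 W) = inner ℂ W (gramOp n U) := by
  rw [inner_gramOp, inner_cell]
  rfl

theorem inner_blochOp_conj (k : Fin n → ℝ) (U W : Sobolev n) :
    inner ℂ (blochOp ha k U) W = inner ℂ U (blochOp ha k W) := by
  have h : (starRingEnd ℂ) (inner ℂ W (blochOp ha k U)) = inner ℂ U (blochOp ha k W) := by
    rw [inner_blochOp, inner_blochOp, map_sum, Finset.sum_comm]
    simp only [map_sum]
    refine Finset.sum_congr rfl fun i _ => Finset.sum_congr rfl fun j _ => ?_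
    rw [inner_conj_symm, inner_coefOp_left, coefOp_comm]
  rw [← h, inner_conj_symm]

end Bloch

namespace Bloch
variable {n : ℕ}

/-! ### The lowest Bloch eigenvalue near `k = 0` -/

variable {a : (Fin n → ℝ) → Matrix (Fin n) (Fin n) ℝ} (ha : IsCoefficientField a)

/-- The ellipticity condition with constant `γ`. -/
def IsElliptic (a : (Fin n → ℝ) → Matrix (Fin n) (Fin n) ℝ) (γ : ℝ) : Prop :=
  ∀ (y : Fin n → ℝ) (ξ : Fin n → ℝ), γ * ∑ i, ξ i ^ 2 ≤ ∑ i, ∑ j, a y i j * ξ i * ξ j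

theorem blochOp_zero : blochOp ha 0 = blochOp₀ ha := by
  simp [blochOp]

theorem blochOp₀_one : blochOp₀ ha (sobolevOne n) = 0 := by
  simp [blochOp₀, weakPartial_one]

theorem inner_one_blochOp₀ (U : Sobolev n) : inner ℂ (sobolevOne n) (blochOp₀ ha U) = 0 := by
  simp [inner_blochOp₀, weakPartial_one]

theorem le_re_inner_blochOp₀ {γ : ℝ} (hγ : IsElliptic a γ) (U : Sobolev n) :
    γ * ∑ j, ‖weakPartial j U‖ ^ 2 ≤ (inner ℂ U (blochOp₀ ha U)).re := by
  rw [inner_blochOp₀]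
  exact le_re_sum_inner_coefOp ha hγ _

/-- On functions with zero average, the form of `𝒜(k)` controls the `L²` norm for small `k`. -/
theorem le_re_inner_blochOp_of_average_eq_zero {γ : ℝ} (hγ0 : 0 < γ) (hγ : IsElliptic a γ)
    {k : Fin n → ℝ} (hk : ∑ j, k j ^ 2 ≤ 1 / 4) {U : Sobolev n} (hU : average n (toL2 U) = 0) :
    γ / 4 * ‖toL2 U‖ ^ 2 ≤ (inner ℂ U (blochOp ha k U)).re := by
  rw [inner_blochOp]
  refine le_trans ?_ (le_re_sum_inner_coefOp ha hγ _)
  have h1 : ∀ j, ‖weakPartial j U‖ ^ 2 / 2 - k j ^ 2 * ‖toL2 U‖ ^ 2 ≤ ‖blochPartial k j U‖ ^ 2 := by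
    intro j
    have h2 : ‖weakPartial j U‖ ≤ ‖blochPartial k j U‖ + |k j| * ‖toL2 U‖ := by
      have e : weakPartial j U = blochPartial k j U - (Complex.I * (k j : ℂ)) • toL2 U := by
        simp [blochPartial]
      rw [e]
      refine (norm_sub_le _ _).trans (add_le_add le_rfl ?_)
      rw [norm_smul, norm_mul, Complex.norm_I, one_mul, Complex.norm_real, Real.norm_eq_abs]
    have h3 : ‖weakPartial j U‖ ^ 2 ≤ (‖blochPartial k j U‖ + |k j| * ‖toL2 U‖) ^ 2 :=
      pow_le_pow_left₀ (norm_nonneg _) h2 2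
    have h4 : (|k j| * ‖toL2 U‖) ^ 2 = k j ^ 2 * ‖toL2 U‖ ^ 2 := by rw [mul_pow, sq_abs]
    nlinarith [sq_nonneg (‖blochPartial k j U‖ - |k j| * ‖toL2 U‖)]
  have h2 := Finset.sum_le_sum fun j (_ : j ∈ Finset.univ) => h1 j
  rw [Finset.sum_sub_distrib, ← Finset.sum_div, ← Finset.sum_mul] at h2
  have h3 := norm_toL2_sq_le_of_average_eq_zero hU
  have h5 : (∑ j, k j ^ 2) * ‖toL2 U‖ ^ 2 ≤ 1 / 4 * ‖toL2 U‖ ^ 2 :=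
    mul_le_mul_of_nonneg_right hk (sq_nonneg _)
  have h6 : 1 / 4 * ‖toL2 U‖ ^ 2 ≤ ∑ j, ‖blochPartial k j U‖ ^ 2 := by linarith
  calc γ / 4 * ‖toL2 U‖ ^ 2 = γ * (1 / 4 * ‖toL2 U‖ ^ 2) := by ring
    _ ≤ _ := mul_le_mul_of_nonneg_left h6 hγ0.le

/-- The cell average of an element of `H¹_per(Y)`. -/
noncomputable def sobolevAverage (n : ℕ) : Sobolev n →L[ℂ] ℂ := (average n).comp toL2

theorem sobolevAverage_apply (U : Sobolev n) : sobolevAverage n U = average n (toL2 U) := rfl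

theorem sobolevAverage_one : sobolevAverage n (sobolevOne n) = 1 := average_cellOne

theorem inner_gramOp_one (U : Sobolev n) : inner ℂ U (gramOp n (sobolevOne n))
    = (((2 * Real.pi) ^ n : ℝ) : ℂ) * conj (sobolevAverage n U) := by
  rw [inner_gramOp, toL2_one, ← inner_conj_symm, inner_cellOne, map_mul, Complex.conj_ofReal]
  rfl

theorem inner_one_gramOp (U : Sobolev n) : inner ℂ (sobolevOne n) (gramOp n U)
    = (((2 * Real.pi) ^ n : ℝ) : ℂ) * sobolevAverage n U := by
  rw [inner_gramOp, toL2_one, inner_cellOne]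
  rfl

theorem sum_norm_sq_weakPartial_le_zero {γ : ℝ} (hγ0 : 0 < γ) (hγ : IsElliptic a γ) {U : Sobolev n}
    (h : inner ℂ U (blochOp₀ ha U) = 0) : ∑ j, ‖weakPartial j U‖ ^ 2 ≤ 0 := by
  have h1 := le_re_inner_blochOp₀ ha hγ U
  rw [h, Complex.zero_re] at h1
  by_contra! h2
  exact absurd h1 (not_le.2 (mul_pos hγ0 h2))

/-- A function with zero average and zero energy vanishes. -/
theorem eq_zero_of_energy_eq_zero {U : Sobolev n} (h : inner ℂ U (blochOp₀ ha U) = 0)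
    (hU : sobolevAverage n U = 0) : U = 0 := by
  obtain ⟨γ, hγ0, hγ⟩ := ha.posDef
  have h1 := sum_norm_sq_weakPartial_le_zero ha hγ0 hγ h
  have h2 := norm_toL2_sq_le_of_average_eq_zero hU
  have h3 : ‖toL2 U‖ ^ 2 = 0 := le_antisymm (h2.trans h1) (sq_nonneg _)
  exact toL2_injective (by simpa using h3)

/-- The linearization at `k = 0` of the eigenvalue problem is bijective: the operator
`-∇·(a ∇ ·)` has the constants as kernel and the functionals vanishing on constants as range. -/
theorem bijective_linearization : Function.Bijective fun p : ℂ × Sobolev n =>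
    (sobolevAverage n p.2, blochOp₀ ha p.2 - p.1 • gramOp n (sobolevOne n)) := by
  obtain ⟨γ, hγ0, hγ⟩ := ha.posDef
  have hvol : (0 : ℝ) < (2 * Real.pi) ^ n := by positivity
  constructor
  · have hlin : ∀ (c : ℂ) (U : Sobolev n), sobolevAverage n U = 0 →
        blochOp₀ ha U = c • gramOp n (sobolevOne n) → c = 0 ∧ U = 0 := by
      intro c U hU h
      have h1 := inner_one_blochOp₀ ha U
      rw [h, inner_smul_right, inner_gramOp_one, sobolevAverage_one, map_one, mul_one] at h1
      have hc : c = 0 := (mul_eq_zero.1 h1).resolve_right cellVolume_ne_zero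
      refine ⟨hc, eq_zero_of_energy_eq_zero ha ?_ hU⟩
      rw [h, hc, zero_smul, inner_zero_right]
    rintro ⟨c, U⟩ ⟨d, W⟩ h
    simp only [Prod.mk.injEq] at h
    have h1 := hlin (c - d) (U - W) (by rw [map_sub, h.1, sub_self]) (by
      rw [map_sub, sub_smul]
      have := h.2
      rw [sub_eq_sub_iff_sub_eq_sub] at this
      exact this)
    rw [sub_eq_zero, sub_eq_zero] at h1
    rw [h1.1, h1.2]
  · -- adding the projection to constants turns `-∇·(a ∇ ·)` into a coercive operator
    set K : Sobolev n →L[ℂ] Sobolev n :=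
      blochOp₀ ha + (sobolevAverage n).smulRight (gramOp n (sobolevOne n)) with hK
    have hcoer : ∀ U, min γ 1 / 3 * ‖U‖ ^ 2 ≤ (inner ℂ U (K U)).re := by
      intro U
      set ℓ := sobolevAverage n U with hℓ
      have h1 : (inner ℂ U (K U)).re
          = (inner ℂ U (blochOp₀ ha U)).re + (2 * Real.pi) ^ n * ‖ℓ‖ ^ 2 := by
        rw [hK, _root_.add_apply, inner_add_right, Complex.add_re,
          ContinuousLinearMap.smulRight_apply, inner_smul_right, inner_gramOp_one, ← hℓ]
        congr 1
        rw [mul_left_comm, Complex.mul_conj, ← Complex.ofReal_mul, Complex.ofReal_re,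
          Complex.normSq_eq_norm_sq]
      have h2 := le_re_inner_blochOp₀ ha hγ U
      set s := ∑ j, ‖weakPartial j U‖ ^ 2 with hs
      have hs0 : 0 ≤ s := Finset.sum_nonneg fun j _ => sq_nonneg _
      set t := (2 * Real.pi) ^ n * ‖ℓ‖ ^ 2 with ht
      have ht0 : 0 ≤ t := by positivity
      -- Poincaré's inequality for `U` minus its average
      have h3 : ‖toL2 U‖ ^ 2 ≤ 2 * s + 2 * t := by
        have h4 : average n (toL2 (U - ℓ • sobolevOne n)) = 0 := by
          rw [← sobolevAverage_apply, map_sub, map_smul, sobolevAverage_one, smul_eq_mul, mul_one,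
            sub_self]
        have h5 := norm_toL2_sq_le_of_average_eq_zero h4
        simp only [map_sub, map_smul, weakPartial_one, smul_zero, sub_zero, toL2_one] at h5
        have h6 : ‖toL2 U‖ ≤ ‖toL2 U - ℓ • cellOne n‖ + ‖ℓ • cellOne n‖ := by
          simpa using norm_add_le (toL2 U - ℓ • cellOne n) (ℓ • cellOne n)
        have h7 : ‖ℓ • cellOne n‖ ^ 2 = t := by
          rw [norm_smul, mul_pow, norm_sq_cellOne, ht, mul_comm]
        have h8 := pow_le_pow_left₀ (norm_nonneg _) h6 2
        nlinarith [sq_nonneg (‖toL2 U - ℓ • cellOne n‖ - ‖ℓ • cellOne n‖)]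
      rw [h1, norm_sq_sobolev, ← hs]
      have hm1 : min γ 1 ≤ γ := min_le_left _ _
      have hm2 : min γ 1 ≤ 1 := min_le_right _ _
      have hm0 : 0 < min γ 1 := lt_min hγ0 one_pos
      have h9 : min γ 1 / 3 * (‖toL2 U‖ ^ 2 + s) ≤ min γ 1 * s + min γ 1 * t := by
        nlinarith
      nlinarith
    have hsurj := surjective_of_coercive K
      (div_pos (lt_min hγ0 one_pos) (by norm_num : (0 : ℝ) < 3)) hcoer
    rintro ⟨c, f⟩
    set v : ℂ := (((2 * Real.pi) ^ n : ℝ) : ℂ) with hv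
    -- the multiple of `gramOp 1` that makes the right-hand side vanish on constants
    set d : ℂ := -(inner ℂ (sobolevOne n) f / v) with hd
    obtain ⟨U, hU⟩ := hsurj (f + d • gramOp n (sobolevOne n))
    have h1 := congrArg (inner ℂ (sobolevOne n)) hU
    rw [hK, _root_.add_apply, inner_add_right, inner_one_blochOp₀, zero_add,
      ContinuousLinearMap.smulRight_apply, inner_smul_right, inner_add_right, inner_smul_right,
      inner_gramOp_one, sobolevAverage_one, map_one, mul_one, ← hv, hd, neg_mul,
      div_mul_cancel₀ _ cellVolume_ne_zero, add_neg_cancel] at h1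
    have h2 : sobolevAverage n U = 0 := (mul_eq_zero.1 h1).resolve_right cellVolume_ne_zero
    rw [hK, _root_.add_apply, ContinuousLinearMap.smulRight_apply, h2, zero_smul, add_zero] at hU
    refine ⟨(d, U + c • sobolevOne n), ?_⟩
    simp only [map_add, map_smul, h2, sobolevAverage_one, blochOp₀_one, hU, smul_eq_mul, mul_one,
      zero_add, smul_zero, add_zero, add_sub_cancel_right]

theorem analyticAt_blochOp (k : Fin n → ℝ) : AnalyticAt ℝ (blochOp ha) k := by
  unfold blochOp
  refine (analyticAt_const.add (Finset.analyticAt_fun_sum _ fun j _ =>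
    (analyticAt_coord j).fun_smul analyticAt_const)).add
    (Finset.analyticAt_fun_sum _ fun i _ => Finset.analyticAt_fun_sum _ fun j _ =>
      (analyticAt_coord i).fun_smul ((analyticAt_coord j).fun_smul analyticAt_const))

theorem isBlochEigenpair_toL2 {k : Fin n → ℝ} {μ : ℝ} {U : Sobolev n} :
    IsBlochEigenpair a k μ (toL2 U) ↔ U ≠ 0 ∧ blochOp ha k U = (μ : ℂ) • gramOp n U := by
  have h0 : toL2 U ≠ 0 ↔ U ≠ 0 := by
    rw [Ne, Ne, not_iff_not, map_eq_zero_iff _ toL2_injective]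
  rw [IsBlochEigenpair, h0]
  constructor
  · rintro ⟨-, hU, h⟩
    refine ⟨hU, ext_inner_left ℂ fun W => ?_⟩
    rw [← blochForm_toL2, h _ (toL2_mem_H1per W), funPair_toL2, inner_smul_right]
  · rintro ⟨hU, h⟩
    refine ⟨toL2_mem_H1per U, hU, fun v hv => ?_⟩
    obtain ⟨W, rfl⟩ := exists_toL2_eq hv
    rw [blochForm_toL2 ha, h, funPair_toL2, inner_smul_right]

/-- For small `k`, all eigenfunctions with small eigenvalues are multiples of each other: a
combination of two of them with zero average would violate the lower bound for the form. -/
theorem eigenpair_unique {γ : ℝ} (hγ0 : 0 < γ) (hγ : IsElliptic a γ) {k : Fin n → ℝ}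
    (hk : ∑ j, k j ^ 2 ≤ 1 / 4) {l m : ℝ} {U W : Sobolev n} (hl : l < γ / 4) (hm : m < γ / 4)
    (hU0 : U ≠ 0) (hU : blochOp ha k U = (l : ℂ) • gramOp n U)
    (hW : blochOp ha k W = (m : ℂ) • gramOp n W) (hW1 : sobolevAverage n W = 1) :
    l = m ∧ U = sobolevAverage n U • W := by
  set c := sobolevAverage n U with hc
  set Z := U - c • W with hZ
  have hZ0 : average n (toL2 Z) = 0 := by
    rw [← sobolevAverage_apply, hZ, map_sub, map_smul, hW1, smul_eq_mul, mul_one, ← hc, sub_self]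
  have hlow := le_re_inner_blochOp_of_average_eq_zero ha hγ0 hγ hk hZ0
  -- eigenfunctions with different eigenvalues are orthogonal in `L²(Y)`
  have horth : ((l : ℂ) - m) * inner ℂ (toL2 U) (toL2 W) = 0 := by
    have h := inner_blochOp_conj ha k U W
    rw [hU, hW, inner_smul_left, inner_smul_right, inner_gramOp, Complex.conj_ofReal,
      ← inner_conj_symm (gramOp n U), inner_gramOp, inner_conj_symm] at h
    rw [sub_mul, h, sub_self]
  set x := toL2 U with hx
  set w := c • toL2 W with hw
  have hZx : toL2 Z = x - w := by rw [hZ, map_sub, map_smul]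
  have hval : inner ℂ Z (blochOp ha k Z) = inner ℂ (x - w) ((l : ℂ) • x - (m : ℂ) • w) := by
    rw [← hZx, hZ, map_sub, map_smul, hU, hW, inner_sub_right, inner_smul_right, inner_smul_right,
      inner_smul_right, inner_gramOp, inner_gramOp, ← hZ, inner_sub_right, inner_smul_right,
      inner_smul_right, hw, inner_smul_right]
    ring
  rw [hval, hZx] at hlow
  have horth' : l ≠ m → inner ℂ x w = 0 := by
    intro hlm
    rw [hw, inner_smul_right]
    have : (l : ℂ) - m ≠ 0 := sub_ne_zero.2 fun h => hlm (Complex.ofReal_injective h)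
    rw [(mul_eq_zero.1 horth).resolve_left this, mul_zero]
  -- on the span of the two eigenfunctions the form is at most `max l m` times the `L²` norm
  have hup : (inner ℂ (x - w) ((l : ℂ) • x - (m : ℂ) • w)).re ≤ max l m * ‖x - w‖ ^ 2 := by
    by_cases hlm : l = m
    · subst hlm
      rw [← smul_sub, inner_smul_right, inner_self_eq_norm_sq_to_K, max_self]
      refine le_of_eq ?_
      norm_cast
      exact Complex.re_ofReal_mul _ _
    · have h1 := horth' hlm
      have h2 : inner ℂ w x = 0 := by rw [← inner_conj_symm, h1, map_zero]
      have h3 : inner ℂ (x - w) ((l : ℂ) • x - (m : ℂ) • w)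
          = ((l * ‖x‖ ^ 2 + m * ‖w‖ ^ 2 : ℝ) : ℂ) := by
        simp only [inner_sub_left, inner_sub_right, inner_smul_right, h1, h2,
          inner_self_eq_norm_sq_to_K]
        push_cast
        simp
      have h4 : ‖x - w‖ ^ 2 = ‖x‖ ^ 2 + ‖w‖ ^ 2 := by
        rw [norm_sub_sq (𝕜 := ℂ), h1]
        simp
      rw [h3, Complex.ofReal_re, h4, mul_add]
      exact add_le_add (mul_le_mul_of_nonneg_right (le_max_left _ _) (sq_nonneg _))
        (mul_le_mul_of_nonneg_right (le_max_right _ _) (sq_nonneg _))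
  have hxw : x - w = 0 := by
    by_contra hne
    have : 0 < ‖x - w‖ ^ 2 := by positivity
    nlinarith [max_lt hl hm]
  refine ⟨?_, ?_⟩
  · by_contra hlm
    have h1 := horth' hlm
    rw [← sub_eq_zero.1 hxw, inner_self_eq_zero, hx, map_eq_zero_iff _ toL2_injective] at h1
    exact hU0 h1
  · have : Z = 0 := toL2_injective (by rw [hZx, hxw, map_zero])
    exact sub_eq_zero.1 this

/-- Existence, simplicity and analyticity of the lowest Bloch eigenvalue and of its normalized
eigenfunction, the latter as a map into `H¹_per(Y)`. -/
theorem exists_analytic_bloch : ∃ ψ : (Fin n → ℝ) → Sobolev n,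
    AnalyticAt ℝ ψ 0 ∧ ψ 0 = sobolevOne n ∧ AnalyticAt ℝ (blochMu a) 0 ∧ blochMu a 0 = 0 ∧
    ∀ᶠ k in 𝓝 (0 : Fin n → ℝ), IsLeast (blochEigenvalues a k) (blochMu a k) ∧
      IsNormalizedBloch a k (toL2 (ψ k)) ∧
      (∀ u, IsNormalizedBloch a k u → u = toL2 (ψ k)) ∧
      blochOp ha k (ψ k) = blochMu a k • gramOp n (ψ k) ∧ sobolevAverage n (ψ k) = 1 := by
  obtain ⟨γ, hγ0, hγ⟩ := ha.posDef
  obtain ⟨μ, ψ, hμ, hψ, hμ0, hψ0, hev⟩ := exists_analytic_eigenpair (analyticAt_blochOp ha 0)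
    (gramOp n) (sobolevAverage n) (sobolevOne n) (by rw [blochOp_zero, blochOp₀_one])
    sobolevAverage_one (by rw [blochOp_zero]; exact bijective_linearization ha)
  have hkey : ∀ᶠ k in 𝓝 (0 : Fin n → ℝ), blochMu a k = (μ k).re ∧
      IsLeast (blochEigenvalues a k) (blochMu a k) ∧ IsNormalizedBloch a k (toL2 (ψ k)) ∧
      (∀ u, IsNormalizedBloch a k u → u = toL2 (ψ k)) ∧
      blochOp ha k (ψ k) = blochMu a k • gramOp n (ψ k) ∧ sobolevAverage n (ψ k) = 1 := by
    have hk : ∀ᶠ k in 𝓝 (0 : Fin n → ℝ), ∑ j, k j ^ 2 ≤ 1 / 4 := by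
      have hc : Continuous fun k : Fin n → ℝ => ∑ j, k j ^ 2 := by fun_prop
      refine (hc.tendsto 0).eventually (eventually_le_nhds ?_)
      simp
    have hs : ∀ᶠ k in 𝓝 (0 : Fin n → ℝ), (μ k).re < γ / 4 := by
      have hc : Tendsto (fun k => (μ k).re) (𝓝 0) (𝓝 (μ 0).re) :=
        (Complex.continuous_re.tendsto _).comp hμ.continuousAt
      rw [hμ0] at hc
      exact hc.eventually (eventually_lt_nhds (by simpa using hγ0))
    filter_upwards [hev, hk, hs] with k hk1 hk2 hk3
    obtain ⟨he, havg⟩ := hk1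
    have hne : ψ k ≠ 0 := by
      intro h
      rw [h, map_zero] at havg
      exact zero_ne_one havg
    -- the eigenvalue is real because the operator is symmetric
    have hreal : ((μ k).re : ℂ) = μ k := by
      have h1 := inner_blochOp_conj ha k (ψ k) (ψ k)
      rw [he, inner_smul_left, inner_smul_right, ← inner_conj_symm (gramOp n (ψ k)), inner_gramOp,
        inner_conj_symm] at h1
      have h2 : inner ℂ (toL2 (ψ k)) (toL2 (ψ k)) ≠ 0 := by
        rw [Ne, inner_self_eq_zero, map_eq_zero_iff _ toL2_injective]
        exact hne
      exact Complex.conj_eq_iff_re.1 (mul_right_cancel₀ h2 h1)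
    have he' : blochOp ha k (ψ k) = ((μ k).re : ℂ) • gramOp n (ψ k) := by rw [hreal, he]
    have hpair : IsBlochEigenpair a k (μ k).re (toL2 (ψ k)) :=
      (isBlochEigenpair_toL2 ha).2 ⟨hne, he'⟩
    -- a smaller eigenvalue would have to coincide with this one
    have hleast : IsLeast (blochEigenvalues a k) (μ k).re := by
      refine ⟨⟨_, hpair⟩, ?_⟩
      rintro l ⟨u, hu⟩
      by_contra! hl
      obtain ⟨U, rfl⟩ := exists_toL2_eq hu.1
      obtain ⟨hU0, hU⟩ := (isBlochEigenpair_toL2 ha).1 hu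
      exact hl.ne (eigenpair_unique ha hγ0 hγ hk2 (hl.trans hk3) hk3 hU0 hU he' havg).1
    have hmu : blochMu a k = (μ k).re := hleast.csInf_eq
    refine ⟨hmu, hmu ▸ hleast, ⟨hmu ▸ hpair, ?_⟩, ?_, ?_, havg⟩
    · rw [← average_eq_setAverage]; exact havg
    · rintro u ⟨hu, hu1⟩
      obtain ⟨U, rfl⟩ := exists_toL2_eq hu.1
      rw [hmu] at hu
      obtain ⟨hU0, hU⟩ := (isBlochEigenpair_toL2 ha).1 hu
      have h1 := (eigenpair_unique ha hγ0 hγ hk2 hk3 hk3 hU0 hU he' havg).2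
      rw [← average_eq_setAverage, ← sobolevAverage_apply] at hu1
      rw [hu1, one_smul] at h1
      rw [h1]
    · rw [hmu, he']
      exact Complex.coe_smul _ _
  refine ⟨ψ, hψ, hψ0, ?_, ?_, hkey.mono fun k hk => hk.2⟩
  · exact ((Complex.reCLM.analyticAt _).comp hμ).congr (hkey.mono fun k hk => hk.1.symm)
  · rw [hkey.self_of_nhds.1, hμ0, Complex.zero_re]

end Bloch

namespace Bloch
variable {n : ℕ}

/-! ### Multi-index sums -/

theorem sum_unitIdx_smul {E : Type*} [AddCommGroup E] [Module ℝ E] (j : Fin n) (F : Fin n → E) :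
    ∑ p, ((unitIdx j p : ℕ) : ℝ) • F p = F j := by
  rw [Finset.sum_eq_single j]
  · simp [unitIdx]
  · intro p _ hp
    simp [unitIdx, Pi.single_eq_of_ne hp]
  · simp

theorem multiDeriv_const_of_ne {E : Type*} [NormedAddCommGroup E] [NormedSpace ℝ E]
    [CompleteSpace E] {α : Fin n → ℕ} (hα : α ≠ 0) (c : E) (x : Fin n → ℝ) :
    multiDeriv α (fun _ => c) x = 0 := by
  induction α using multiIdx_induction with
  | h0 => exact absurd rfl hα
  | hs α j _ =>
    rw [(multiDeriv_add_unitIdx α j analyticAt_const).self_of_nhds]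
    have : partialDeriv j (fun _ : Fin n → ℝ => c) = fun _ => 0 := by
      funext k
      simp [partialDeriv]
    rw [this, multiDeriv_fun_zero]

theorem unitIdx_ne_zero (j : Fin n) : unitIdx j ≠ 0 := by
  simp [unitIdx]

/-- The coefficient is `α_i (α_i - 1)` on the diagonal and `α_i α_j` off it. -/
theorem multiBinom_unitIdx_add_unitIdx (α : Fin n → ℕ) (i j : Fin n) :
    α i * (α - unitIdx i) j = multiBinom α (unitIdx i + unitIdx j) * (if i = j then 2 else 1) := by
  by_cases hij : i = j
  · subst hij
    rw [multiBinom, Finset.prod_eq_single i]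
    · have h := Nat.descFactorial_eq_factorial_mul_choose (α i) 2
      simp only [Nat.descFactorial, Nat.factorial] at h
      simp only [unitIdx, Pi.add_apply, Pi.sub_apply, Pi.single_eq_same, if_true]
      norm_num at h ⊢
      rw [mul_comm, h, mul_comm]
    · intro l _ hl
      simp [unitIdx, Pi.single_eq_of_ne hl]
    · simp
  · rw [multiBinom, Finset.prod_eq_mul i j hij]
    · simp [unitIdx, hij]
    · intro l _ hl
      simp [unitIdx, Pi.single_eq_of_ne hl.1, Pi.single_eq_of_ne hl.2]
    · simp
    · simp

/-- The second-order terms of the Leibniz rule, collected over unordered pairs of indices. -/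
theorem sum_sum_multiIdx_eq (α : Fin n → ℕ) {X : Fin n → Fin n → ℂ} (hX : ∀ i j, X i j = X j i) :
    ∑ i, ∑ j, (α i : ℂ) * ((((α - unitIdx i) j : ℕ) : ℂ) * X i j)
      = 2 * ∑ i, ∑ j ∈ Finset.Ici i, (multiBinom α (unitIdx i + unitIdx j) : ℂ) * X i j := by
  set Z : Fin n → Fin n → ℂ := fun i j => (multiBinom α (unitIdx i + unitIdx j) : ℂ) * X i j with hZ
  have hZs : ∀ i j, Z i j = Z j i := fun i j => by
    simp only [hZ, hX i j, add_comm (unitIdx i)]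
  have h1 : ∀ i j, (α i : ℂ) * ((((α - unitIdx i) j : ℕ) : ℂ) * X i j)
      = (if i ≤ j then Z i j else 0) + (if j ≤ i then Z i j else 0) := by
    intro i j
    have h := congrArg (Nat.cast : ℕ → ℂ) (multiBinom_unitIdx_add_unitIdx α i j)
    push_cast at h
    rw [← mul_assoc, h]
    rcases lt_trichotomy i j with hij | hij | hij
    · simp [hij.le, hij.not_ge, hij.ne, hZ]
    · subst hij
      simp [hZ]; ring
    · simp [hij.le, hij.not_ge, hij.ne', hZ]
  have h2 : ∀ i, ∑ j ∈ Finset.Ici i, Z i j = ∑ j, if i ≤ j then Z i j else 0 := by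
    intro i
    rw [← Finset.sum_filter]
    refine Finset.sum_congr ?_ fun _ _ => rfl
    ext j; simp
  rw [show (∑ i, ∑ j ∈ Finset.Ici i, (multiBinom α (unitIdx i + unitIdx j) : ℂ) * X i j)
    = ∑ i, ∑ j, if i ≤ j then Z i j else 0 from Finset.sum_congr rfl fun i _ => h2 i]
  simp only [h1, Finset.sum_add_distrib, two_mul]
  congr 1
  rw [Finset.sum_comm]
  exact Finset.sum_congr rfl fun i _ => Finset.sum_congr rfl fun j _ => by rw [hZs]

/-! ### Derivatives of the operator family and the weak formulation of its coefficients -/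

variable {a : (Fin n → ℝ) → Matrix (Fin n) (Fin n) ℝ} (ha : IsCoefficientField a)

/-- The Leibniz rule for `k ↦ 𝒜(k) f(k)`, a polynomial of degree two in `k` acting on `f`. -/
theorem multiDeriv_blochOp_apply (α : Fin n → ℕ) {f : (Fin n → ℝ) → Sobolev n}
    (hf : AnalyticAt ℝ f 0) :
    multiDeriv α (fun k => blochOp ha k (f k)) 0
      = blochOp₀ ha (multiDeriv α f 0)
        + ∑ j, (α j : ℝ) • blochOp₁ ha j (multiDeriv (α - unitIdx j) f 0)
        + ∑ i, ∑ j, (α i : ℝ) • ((((α - unitIdx i) j : ℕ) : ℝ) •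
            blochOp₂ ha i j (multiDeriv (α - unitIdx i - unitIdx j) f 0)) := by
  have hL : ∀ (L : Sobolev n →L[ℂ] Sobolev n), AnalyticAt ℝ (fun k => L (f k)) 0 := fun L =>
    ((L.restrictScalars ℝ).analyticAt _).comp hf
  have hD : ∀ (L : Sobolev n →L[ℂ] Sobolev n) (β : Fin n → ℕ),
      multiDeriv β (fun k => L (f k)) 0 = L (multiDeriv β f 0) := fun L β =>
    (multiDeriv_clm β (L.restrictScalars ℝ) hf).self_of_nhds
  have h1 : ∀ j, AnalyticAt ℝ (fun k : Fin n → ℝ => k j • blochOp₁ ha j (f k)) 0 := fun j =>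
    (analyticAt_coord j).fun_smul (hL _)
  have h2' : ∀ i j, AnalyticAt ℝ (fun k : Fin n → ℝ => k j • blochOp₂ ha i j (f k)) 0 :=
    fun i j => (analyticAt_coord j).fun_smul (hL _)
  have h2 : ∀ i j, AnalyticAt ℝ (fun k : Fin n → ℝ => k i • (k j • blochOp₂ ha i j (f k))) 0 :=
    fun i j => (analyticAt_coord i).fun_smul (h2' i j)
  have h3 : ∀ i, AnalyticAt ℝ (fun k : Fin n → ℝ => ∑ j, k i • (k j • blochOp₂ ha i j (f k))) 0 :=
    fun i => Finset.analyticAt_fun_sum _ fun j _ => h2 i j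
  have hs1 := Finset.analyticAt_fun_sum Finset.univ fun j _ => h1 j
  have hs2 := Finset.analyticAt_fun_sum Finset.univ fun i _ => h3 i
  have he : (fun k => blochOp ha k (f k)) = fun k => (blochOp₀ ha (f k)
      + ∑ j, k j • blochOp₁ ha j (f k)) + ∑ i, ∑ j, k i • (k j • blochOp₂ ha i j (f k)) := by
    funext k
    simp only [blochOp, _root_.add_apply, _root_.sum_apply, _root_.smul_apply]
  rw [he, (multiDeriv_add α ((hL _).fun_add hs1) hs2).self_of_nhds]
  beta_reduce
  rw [(multiDeriv_add α (hL _) hs1).self_of_nhds]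
  beta_reduce
  rw [multiDeriv_sum _ _ fun j _ => h1 j, multiDeriv_sum _ _ fun i _ => h3 i, hD]
  congr 1
  · congr 1
    refine Finset.sum_congr rfl fun j _ => ?_
    rw [multiDeriv_coord_smul_zero α j (hL _), hD]
  · refine Finset.sum_congr rfl fun i _ => ?_
    rw [multiDeriv_sum _ _ fun j _ => h2 i j]
    refine Finset.sum_congr rfl fun j _ => ?_
    rw [multiDeriv_coord_smul_zero α i (h2' i j), multiDeriv_coord_smul_zero _ j (hL _), hD]

/-- The coefficients `𝒜^α` of the form are represented by the derivatives of the operator. -/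
theorem formD_toL2 (α : Fin n → ℕ) (U W : Sobolev n) : formD a α (toL2 U) (toL2 W)
    = inner ℂ W (multiDeriv α (fun k => blochOp ha k U) 0) := by
  simp only [formD, blochForm_toL2 ha]
  have hA : AnalyticAt ℝ (fun k => blochOp ha k U) 0 :=
    (((ContinuousLinearMap.apply ℂ (Sobolev n) U).restrictScalars ℝ).analyticAt _).comp
      (analyticAt_blochOp ha 0)
  exact (multiDeriv_clm α ((innerSL ℂ W).restrictScalars ℝ) hA).self_of_nhds

theorem formD_zero (U W : Sobolev n) :
    formD a 0 (toL2 U) (toL2 W) = inner ℂ W (blochOp₀ ha U) := by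
  rw [formD_toL2 ha, multiDeriv_blochOp_apply ha 0 analyticAt_const]
  simp [multiDeriv_zero]

theorem formD_unitIdx (j : Fin n) (U W : Sobolev n) :
    formD a (unitIdx j) (toL2 U) (toL2 W) = inner ℂ W (blochOp₁ ha j U) := by
  rw [formD_toL2 ha, multiDeriv_blochOp_apply ha _ analyticAt_const,
    multiDeriv_const_of_ne (unitIdx_ne_zero j), sum_unitIdx_smul]
  simp only [← Finset.smul_sum]
  rw [sum_unitIdx_smul]
  simp [multiDeriv_zero]

theorem blochOp₂_comm (i j : Fin n) : blochOp₂ ha i j = blochOp₂ ha j i := by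
  rw [blochOp₂, coefOp_comm, blochOp₂]

theorem formD_unitIdx_add_unitIdx (i j : Fin n) (U W : Sobolev n) :
    formD a (unitIdx i + unitIdx j) (toL2 U) (toL2 W) = 2 * inner ℂ W (blochOp₂ ha i j U) := by
  have h0 : unitIdx i + unitIdx j ≠ 0 := fun h => unitIdx_ne_zero i (by
    funext l
    have := congrFun h l
    simp only [Pi.add_apply, Pi.zero_apply] at this ⊢
    omega)
  rw [formD_toL2 ha, multiDeriv_blochOp_apply ha _ analyticAt_const, multiDeriv_const_of_ne h0]
  simp only [← Finset.smul_sum, Pi.add_apply, Nat.cast_add, add_smul, Finset.sum_add_distrib,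
    sum_unitIdx_smul]
  rw [add_tsub_cancel_left, add_tsub_cancel_right, sum_unitIdx_smul, sum_unitIdx_smul,
    multiDeriv_const_of_ne (unitIdx_ne_zero i), multiDeriv_const_of_ne (unitIdx_ne_zero j),
    tsub_self, tsub_self, multiDeriv_zero, blochOp₂_comm ha j i]
  simp [two_mul]

theorem flux_toL2 (U : Sobolev n) (y : Fin n → ℝ) (j : Fin n) :
    flux a (toL2 U) y j = ∑ l, (a y j l : ℂ) * weakPartial l U y := by
  simp only [flux, wgrad_toL2]

include ha in
theorem funPair_flux (j : Fin n) (U W : Sobolev n) :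
    funPair (fun y => flux a (toL2 U) y j) (toL2 W)
      = ∑ l, inner ℂ (toL2 W) (coefOp ha j l (weakPartial l U)) := by
  simp only [inner_coefOp]
  rw [← integral_finsetSum _ fun l _ => integrable_coef_mul ha j l _ _, funPair]
  refine integral_congr_ae (Eventually.of_forall fun y => ?_)
  simp only [flux_toL2, Finset.sum_mul]

include ha in
theorem divPair_coef (j : Fin n) (U W : Sobolev n) :
    divPair (fun y i => toL2 U y * (a y i j : ℂ)) (toL2 W)
      = -∑ i, inner ℂ (weakPartial i W) (coefOp ha i j (toL2 U)) := by
  simp only [inner_coefOp]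
  rw [← integral_finsetSum _ fun l _ => integrable_coef_mul ha l j _ _, divPair]
  congr 1
  refine integral_congr_ae (Eventually.of_forall fun y => ?_)
  simp only [wgrad_toL2, mul_comm (toL2 U y)]

theorem inner_blochOp₁_eq_pair (j : Fin n) (U W : Sobolev n) :
    inner ℂ W (blochOp₁ ha j U) = -(Complex.I * (funPair (fun y => flux a (toL2 U) y j) (toL2 W)
      + divPair (fun y i => toL2 U y * (a y i j : ℂ)) (toL2 W))) := by
  rw [inner_blochOp₁, funPair_flux ha, divPair_coef ha, Finset.sum_sub_distrib]
  ring

theorem inner_blochOp₂_eq_pair (i j : Fin n) (U W : Sobolev n) :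
    inner ℂ W (blochOp₂ ha i j U) = funPair (fun y => (a y i j : ℂ) * toL2 U y) (toL2 W) := by
  rw [inner_blochOp₂, inner_coefOp]
  rfl

theorem inner_blochOp₀_eq_pair (U W : Sobolev n) :
    inner ℂ W (blochOp₀ ha U) = -divPair (flux a (toL2 U)) (toL2 W) := by
  rw [inner_blochOp₀, divPair, neg_neg]
  simp only [inner_coefOp]
  have hint := fun i j => integrable_coef_mul ha i j (weakPartial i W) (weakPartial j U)
  rw [Finset.sum_congr rfl fun i _ => (integral_finsetSum Finset.univ fun j _ => hint i j).symm,
    ← integral_finsetSum _ fun i _ => integrable_finsetSum _ fun j _ => hint i j]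
  refine integral_congr_ae (Eventually.of_forall fun y => ?_)
  simp only [flux_toL2, wgrad_toL2, Finset.sum_mul]

include ha in
theorem integrable_coef_toL2 (i j : Fin n) (U : Sobolev n) :
    Integrable (fun y => (a y i j : ℂ) * toL2 U y) (volume.restrict (cell n)) :=
  (integrable_cell (coefOp ha i j (toL2 U))).congr (coeFn_mulOp (ha.continuous i j) _)

include ha in
theorem integrable_flux (U : Sobolev n) (j : Fin n) :
    Integrable (fun y => flux a (toL2 U) y j) (volume.restrict (cell n)) := by
  simp only [flux_toL2]
  exact integrable_finsetSum _ fun l _ =>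
    (integrable_cell (coefOp ha j l (weakPartial l U))).congr (coeFn_mulOp (ha.continuous j l) _)

theorem funPair_one (f : (Fin n → ℝ) → ℂ) : funPair f (toL2 (sobolevOne n))
    = (((2 * Real.pi) ^ n : ℝ) : ℂ) * ⨍ y in cell n, f y := by
  rw [setAverage_cell, ← mul_assoc, mul_inv_cancel₀ cellVolume_ne_zero, one_mul, funPair, toL2_one]
  exact integral_congr_ae (coeFn_cellOne.mono fun y hy => by simp only [hy, map_one, mul_one])

theorem inner_one_blochOp₁ (j : Fin n) (U : Sobolev n) :
    inner ℂ (sobolevOne n) (blochOp₁ ha j U) = (((2 * Real.pi) ^ n : ℝ) : ℂ) *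
      -(Complex.I * ⨍ y in cell n, flux a (toL2 U) y j) := by
  rw [inner_blochOp₁_eq_pair, funPair_one, divPair_coef ha]
  simp only [weakPartial_one, inner_zero_left, Finset.sum_const_zero, neg_zero, add_zero]
  ring

theorem inner_one_blochOp₂ (i j : Fin n) (U : Sobolev n) :
    inner ℂ (sobolevOne n) (blochOp₂ ha i j U) = (((2 * Real.pi) ^ n : ℝ) : ℂ) *
      ⨍ y in cell n, (a y i j : ℂ) * toL2 U y := by
  rw [inner_blochOp₂_eq_pair, funPair_one]

/-! ### Symmetry under complex conjugation -/

theorem hasWeakDeriv_wgrad {u : CellL2 n} (hu : u ∈ H1per n) (j : Fin n) :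
    HasWeakDeriv j u (wgrad u j) := by
  rw [wgrad, dif_pos (hu j)]
  exact (hu j).choose_spec

theorem star_mem_H1per {u : CellL2 n} (hu : u ∈ H1per n) : star u ∈ H1per n :=
  fun j => ⟨_, (hasWeakDeriv_wgrad hu j).star⟩

theorem wgrad_star {u : CellL2 n} (hu : u ∈ H1per n) (j : Fin n) :
    wgrad (star u) j = star (wgrad u j) :=
  (hasWeakDeriv_wgrad (star_mem_H1per hu) j).unique (hasWeakDeriv_wgrad hu j).star

theorem blochForm_neg_star (k : Fin n → ℝ) {u v : CellL2 n} (hu : u ∈ H1per n) (hv : v ∈ H1per n) :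
    blochForm a (-k) (star u) (star v) = conj (blochForm a k u v) := by
  rw [blochForm, blochForm, ← integral_conj]
  refine integral_congr_ae ?_
  filter_upwards [coeFn_star_cell u, coeFn_star_cell v,
    ae_all_iff.2 fun j => coeFn_star_cell (wgrad u j),
    ae_all_iff.2 fun j => coeFn_star_cell (wgrad v j)] with y h1 h2 h3 h4
  simp only [wgrad_star hu, wgrad_star hv, h1, h2, h3, h4, map_sum, map_mul, map_add,
    map_neg, Complex.conj_ofReal, Complex.conj_I, Complex.conj_conj, Pi.neg_apply,
    Complex.ofReal_neg]
  exact Finset.sum_congr rfl fun i _ => Finset.sum_congr rfl fun j _ => by ring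

theorem funPair_star (u v : CellL2 n) : funPair (star u : CellL2 n) (star v)
    = conj (funPair u v) := by
  rw [funPair, funPair, ← integral_conj]
  refine integral_congr_ae ?_
  filter_upwards [coeFn_star_cell u, coeFn_star_cell v] with y h1 h2
  rw [h1, h2, map_mul]

theorem isBlochEigenpair_star {k : Fin n → ℝ} {μ : ℝ} {u : CellL2 n}
    (h : IsBlochEigenpair a k μ u) : IsBlochEigenpair a (-k) μ (star u) := by
  obtain ⟨hu, hu0, h⟩ := h
  refine ⟨star_mem_H1per hu, fun h0 => hu0 ?_, fun v hv => ?_⟩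
  · rw [← star_star u, h0]
    have h1 : ∀ᵐ y ∂(volume.restrict (cell n)), (star (0 : CellL2 n) : CellL2 n) y
        = (0 : CellL2 n) y := by
      filter_upwards [coeFn_star_cell (0 : CellL2 n), Lp.coeFn_zero ℂ 2 (volume.restrict (cell n))]
        with y h1 h2
      rw [h1, h2]
      simp
    exact Lp.ext h1
  · rw [← star_star v, blochForm_neg_star k hu (star_mem_H1per hv), h _ (star_mem_H1per hv),
      funPair_star, map_mul, Complex.conj_ofReal]

/-- Conjugating an eigenfunction reverses `k`, so `μ₀` is even. -/
theorem blochMu_neg (k : Fin n → ℝ) : blochMu a (-k) = blochMu a k := by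
  have h : blochEigenvalues a (-k) = blochEigenvalues a k := by
    ext μ
    constructor
    · rintro ⟨u, hu⟩
      exact ⟨_, by simpa using isBlochEigenpair_star hu⟩
    · rintro ⟨u, hu⟩
      exact ⟨_, isBlochEigenpair_star hu⟩
  rw [blochMu, h, blochMu]

end Bloch

namespace Bloch
variable {n : ℕ}

/-! ### The hierarchy of cell problems -/

variable {a : (Fin n → ℝ) → Matrix (Fin n) (Fin n) ℝ} (ha : IsCoefficientField a)

/-- The derivative `∂^α` at `k = 0` of the equation `𝒜(k) ψ(k) = μ₀(k) ψ(k)`, tested with `W`. -/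
theorem hierarchy {ψ : (Fin n → ℝ) → Sobolev n} (hψ : AnalyticAt ℝ ψ 0)
    (hμ : AnalyticAt ℝ (blochMu a) 0)
    (he : ∀ᶠ k in 𝓝 0, blochOp ha k (ψ k) = blochMu a k • gramOp n (ψ k)) (α : Fin n → ℕ)
    (W : Sobolev n) :
    inner ℂ W (blochOp₀ ha (multiDeriv α ψ 0))
        + ∑ j, (α j : ℂ) * inner ℂ W (blochOp₁ ha j (multiDeriv (α - unitIdx j) ψ 0))
        + ∑ i, ∑ j, (α i : ℂ) * ((((α - unitIdx i) j : ℕ) : ℂ) *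
            inner ℂ W (blochOp₂ ha i j (multiDeriv (α - unitIdx i - unitIdx j) ψ 0)))
      = ∑ β ∈ Finset.Iic α, (multiBinom α β : ℂ) * (muD a β : ℂ) *
          inner ℂ W (gramOp n (multiDeriv (α - β) ψ 0)) := by
  have h1 := (multiDeriv_congr α he).self_of_nhds
  have hS : AnalyticAt ℝ (fun k => gramOp n (ψ k)) 0 :=
    (((gramOp n).restrictScalars ℝ).analyticAt _).comp hψ
  have hDS : ∀ β, multiDeriv β (fun k => gramOp n (ψ k)) 0 = gramOp n (multiDeriv β ψ 0) :=
    fun β => (multiDeriv_clm β ((gramOp n).restrictScalars ℝ) hψ).self_of_nhds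
  rw [multiDeriv_blochOp_apply ha α hψ, (multiDeriv_smul α hμ hS).self_of_nhds] at h1
  have h2 := congrArg (inner ℂ W) h1
  have hsm : ∀ (r : ℝ) (U : Sobolev n), inner ℂ W (r • U) = (r : ℂ) * inner ℂ W U := fun r U => by
    rw [← Complex.coe_smul, inner_smul_right]
  simp only [inner_add_right, inner_sum, hsm, hDS, ← Nat.cast_smul_eq_nsmul ℝ,
    Complex.ofReal_natCast, ← mul_assoc] at h2
  simp only [← mul_assoc]
  exact h2

/-- The normalization `⟨ψ(k)⟩ = 1` does not depend on `k`, so the derivatives average to zero. -/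
theorem cell_average_eq (ψ : (Fin n → ℝ) → Sobolev n) (hψ : AnalyticAt ℝ ψ 0)
    (havg : ∀ᶠ k in 𝓝 0, sobolevAverage n (ψ k) = 1) {α : Fin n → ℕ} (hα : α ≠ 0) :
    sobolevAverage n (multiDeriv α ψ 0) = 0 := by
  have h1 := (multiDeriv_clm α ((sobolevAverage n).restrictScalars ℝ) hψ).self_of_nhds
  have h2 : (fun k => (sobolevAverage n).restrictScalars ℝ (ψ k)) =ᶠ[𝓝 0] fun _ => (1 : ℂ) := havg
  rw [(multiDeriv_congr α h2).self_of_nhds, multiDeriv_const_of_ne hα] at h1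
  exact h1.symm

/-- Testing the hierarchy with the constant function `1` expresses `μ₀^α` by averages. -/
theorem muD_eq_sum {ψ : (Fin n → ℝ) → Sobolev n} (hψ : AnalyticAt ℝ ψ 0)
    (hμ : AnalyticAt ℝ (blochMu a) 0) (hψ0 : ψ 0 = sobolevOne n)
    (he : ∀ᶠ k in 𝓝 0, blochOp ha k (ψ k) = blochMu a k • gramOp n (ψ k))
    (havg : ∀ᶠ k in 𝓝 0, sobolevAverage n (ψ k) = 1) (α : Fin n → ℕ) :
    (muD a α : ℂ) = ∑ j, (α j : ℂ) *
        -(Complex.I * ⨍ y in cell n, flux a (toL2 (multiDeriv (α - unitIdx j) ψ 0)) y j)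
      + ∑ i, ∑ j, (α i : ℂ) * ((((α - unitIdx i) j : ℕ) : ℂ) *
          ⨍ y in cell n, (a y i j : ℂ) * toL2 (multiDeriv (α - unitIdx i - unitIdx j) ψ 0) y) := by
  have h := hierarchy ha hψ hμ he α (sobolevOne n)
  have hr : ∑ β ∈ Finset.Iic α, (multiBinom α β : ℂ) * (muD a β : ℂ) *
      inner ℂ (sobolevOne n) (gramOp n (multiDeriv (α - β) ψ 0))
      = (((2 * Real.pi) ^ n : ℝ) : ℂ) * (muD a α : ℂ) := by
    rw [Finset.sum_eq_single α]
    · rw [tsub_self, multiDeriv_zero, hψ0, inner_one_gramOp, sobolevAverage_one, multiBinom_self]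
      push_cast
      ring
    · intro β hβ hne
      have h0 : α - β ≠ 0 := fun h0 =>
        hne (le_antisymm (Finset.mem_Iic.1 hβ) (tsub_eq_zero_iff_le.1 h0))
      rw [inner_one_gramOp, cell_average_eq ψ hψ havg h0, mul_zero, mul_zero]
    · intro h0
      exact absurd (Finset.mem_Iic.2 le_rfl) h0
  rw [hr, inner_one_blochOp₀, zero_add] at h
  simp only [inner_one_blochOp₁, inner_one_blochOp₂] at h
  refine mul_left_cancel₀ (cellVolume_ne_zero (n := n)) (h.symm.trans ?_)
  rw [mul_add]
  simp only [Finset.mul_sum]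
  congr 1
  · exact Finset.sum_congr rfl fun j _ => by ring
  · exact Finset.sum_congr rfl fun i _ => Finset.sum_congr rfl fun j _ => by ring

theorem sum_unitIdx_mul (j : Fin n) (F : Fin n → ℂ) : ∑ p, ((unitIdx j p : ℕ) : ℂ) * F p = F j := by
  have h := sum_unitIdx_smul j F
  simpa only [Complex.real_smul, Complex.ofReal_natCast] using h

theorem setAverage_add {f g : (Fin n → ℝ) → ℂ} (hf : Integrable f (volume.restrict (cell n)))
    (hg : Integrable g (volume.restrict (cell n))) :
    ⨍ y in cell n, (f y + g y) = (⨍ y in cell n, f y) + ⨍ y in cell n, g y := by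
  simp only [setAverage_cell, integral_add hf hg, mul_add]

theorem setAverage_sub {f g : (Fin n → ℝ) → ℂ} (hf : Integrable f (volume.restrict (cell n)))
    (hg : Integrable g (volume.restrict (cell n))) :
    ⨍ y in cell n, (f y - g y) = (⨍ y in cell n, f y) - ⨍ y in cell n, g y := by
  simp only [setAverage_cell, integral_sub hf hg, mul_sub]

theorem setAverage_const_mul (c : ℂ) (f : (Fin n → ℝ) → ℂ) :
    ⨍ y in cell n, c * f y = c * ⨍ y in cell n, f y := by
  simp only [setAverage_cell, integral_const_mul, mul_left_comm]

end Bloch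

open Bloch
theorem mainTheorem4 (n : ℕ) (hn : 1 ≤ n) (a : (Fin n → ℝ) → Matrix (Fin n) (Fin n) ℝ)
    (ha : IsCoefficientField a) :
    -- near `k = 0`, `μ₀(k)` is the smallest eigenvalue and its normalized eigenfunction `ψ₀(·, k)`
    -- exists and is unique; both depend analytically on `k`
    (∀ᶠ k in 𝓝 (0 : Fin n → ℝ),
      IsLeast (blochEigenvalues a k) (blochMu a k) ∧
      IsNormalizedBloch a k (blochPsi a k) ∧
      ∀ u, IsNormalizedBloch a k u → u = blochPsi a k) ∧
    AnalyticAt ℝ (blochMu a) 0 ∧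
    AnalyticAt ℝ (blochPsi a) 0 ∧
    -- values at `k = 0` and zero averages
    muD a 0 = 0 ∧
    (∀ᵐ y ∂(volume.restrict (cell n)), psiD a 0 y = 1) ∧
    (∀ α : Fin n → ℕ, α ≠ 0 → (⨍ y in cell n, psiD a α y) = 0) ∧
    -- the hierarchy, in terms of the operators `𝒜^α`
    (∀ α : Fin n → ℕ, psiD a α ∈ H1per n) ∧
    (∀ α : Fin n → ℕ, ∀ v ∈ H1per n,
      formD a 0 (psiD a α) v
        + ∑ j, (α j : ℂ) * formD a (unitIdx j) (psiD a (α - unitIdx j)) v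
        + ∑ i, ∑ j ∈ Finset.Ici i, (multiBinom α (unitIdx i + unitIdx j) : ℂ) *
            formD a (unitIdx i + unitIdx j) (psiD a (α - unitIdx i - unitIdx j)) v
      = ∑ β ∈ Finset.Iic α,
          (multiBinom α β : ℂ) * (muD a β : ℂ) * funPair (psiD a (α - β)) v) ∧
    -- the explicit cell problems, with unique solvability
    (∀ α : Fin n → ℕ, SolvesCellProblem a α (psiD a α)) ∧
    (∀ α : Fin n → ℕ, α ≠ 0 → ∀ w : CellL2 n,
      SolvesCellProblem a α w → (⨍ y in cell n, w y) = 0 → w = psiD a α) ∧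
    -- formulas for `μ₀^α`
    (∀ α : Fin n → ℕ, Odd (∑ i, α i) → muD a α = 0) ∧
    (∀ α : Fin n → ℕ, 1 ≤ ∑ i, α i → Even (∑ i, α i) →
      (muD a α : ℂ) =
        2 * ∑ i, ∑ j ∈ Finset.Ici i, (multiBinom α (unitIdx i + unitIdx j) : ℂ) *
            (⨍ y in cell n, (a y i j : ℂ) * psiD a (α - unitIdx i - unitIdx j) y)
        - Complex.I * ∑ j, (α j : ℂ) *
            (⨍ y in cell n, flux a (psiD a (α - unitIdx j)) y j)) ∧
    -- the tensors `A` and `C`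
    ((fun k : Fin n → ℝ => blochMu a k
        - (∑ i, ∑ j, tensorA a i j * k i * k j
          + ∑ i, ∑ j, ∑ l, ∑ m, tensorC a i j l m * k i * k j * k l * k m))
      =O[𝓝 0] fun k : Fin n → ℝ => (∑ i, k i ^ 2) ^ 3) ∧
    (∀ i j : Fin n,
      (tensorA a i j : ℂ) =
        ⨍ y in cell n, ((a y i j : ℂ)
          - Complex.I / 2 * (flux a (psiD a (unitIdx j)) y i
            + flux a (psiD a (unitIdx i)) y j))) ∧
    (∀ i j k l : Fin n,
      (tensorC a i j k l : ℂ) =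
        1 / 24 * ⨍ y in cell n,
          (2 * ((a y i j : ℂ) * psiD a (unitIdx k + unitIdx l) y
              + (a y i k : ℂ) * psiD a (unitIdx j + unitIdx l) y
              + (a y i l : ℂ) * psiD a (unitIdx j + unitIdx k) y
              + (a y j k : ℂ) * psiD a (unitIdx i + unitIdx l) y
              + (a y j l : ℂ) * psiD a (unitIdx i + unitIdx k) y
              + (a y k l : ℂ) * psiD a (unitIdx i + unitIdx j) y)
            - Complex.I * (flux a (psiD a (unitIdx j + unitIdx k + unitIdx l)) y i
              + flux a (psiD a (unitIdx i + unitIdx k + unitIdx l)) y j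
              + flux a (psiD a (unitIdx i + unitIdx j + unitIdx l)) y k
              + flux a (psiD a (unitIdx i + unitIdx j + unitIdx k)) y l))) := by
  obtain ⟨ψ, hψ, hψ0, hμ, hμ0, hev⟩ := exists_analytic_bloch ha
  have he : ∀ᶠ k in 𝓝 0, blochOp ha k (ψ k) = blochMu a k • gramOp n (ψ k) :=
    hev.mono fun k hk => hk.2.2.2.1
  have havg : ∀ᶠ k in 𝓝 0, sobolevAverage n (ψ k) = 1 := hev.mono fun k hk => hk.2.2.2.2
  -- the branch `ψ` is `ψ₀(·, k)`, seen in `H¹_per(Y)`, and the embedding commutes with derivatives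
  have hpsi : blochPsi a =ᶠ[𝓝 0] fun k => toL2 (ψ k) := by
    filter_upwards [hev] with k hk
    have h : ∃ u, IsNormalizedBloch a k u := ⟨_, hk.2.1⟩
    rw [blochPsi, dif_pos h]
    exact hk.2.2.1 _ h.choose_spec
  have hpsiA : AnalyticAt ℝ (fun k => toL2 (ψ k)) 0 :=
    ((toL2.restrictScalars ℝ).analyticAt _).comp hψ
  set Ψ : (Fin n → ℕ) → Sobolev n := fun α => multiDeriv α ψ 0 with hΨ
  have hpsiD : ∀ α, psiD a α = toL2 (Ψ α) := fun α =>
    (multiDeriv_congr α hpsi).self_of_nhds.trans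
      (multiDeriv_clm α (toL2.restrictScalars ℝ) hψ).self_of_nhds
  have hΨ0 : Ψ 0 = sobolevOne n := by rw [hΨ]; simp only [multiDeriv_zero, hψ0]
  have hmu0 : muD a 0 = 0 := by rw [muD, multiDeriv_zero, hμ0]
  have hone : ∀ᵐ y ∂(volume.restrict (cell n)), psiD a 0 y = 1 := by
    rw [hpsiD, hΨ0, toL2_one]
    exact coeFn_cellOne
  have hmean : ∀ α : Fin n → ℕ, α ≠ 0 → (⨍ y in cell n, psiD a α y) = 0 := by
    intro α hα
    rw [hpsiD, ← average_eq_setAverage]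
    exact cell_average_eq ψ hψ havg hα
  have hmem : ∀ α : Fin n → ℕ, psiD a α ∈ H1per n := fun α => hpsiD α ▸ toL2_mem_H1per _
  -- the hierarchy with the second-order terms summed over `i ≤ j` only
  have hier : ∀ (α : Fin n → ℕ) (W : Sobolev n), inner ℂ W (blochOp₀ ha (Ψ α))
        + ∑ j, (α j : ℂ) * inner ℂ W (blochOp₁ ha j (Ψ (α - unitIdx j)))
        + 2 * ∑ i, ∑ j ∈ Finset.Ici i, (multiBinom α (unitIdx i + unitIdx j) : ℂ) *
            inner ℂ W (blochOp₂ ha i j (Ψ (α - unitIdx i - unitIdx j)))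
      = ∑ β ∈ Finset.Iic α, (multiBinom α β : ℂ) * (muD a β : ℂ) *
          inner ℂ W (gramOp n (Ψ (α - β))) := by
    intro α W
    rw [← hierarchy ha hψ hμ he α W]
    congr 1
    refine (sum_sum_multiIdx_eq α fun i j => ?_).symm
    rw [blochOp₂_comm ha i j, tsub_right_comm]
  have hcell : ∀ α : Fin n → ℕ, SolvesCellProblem a α (psiD a α) := by
    intro α
    refine ⟨hmem α, fun v hv => ?_⟩
    obtain ⟨W, rfl⟩ := exists_toL2_eq hv
    have h := hier α W
    -- the term `β = 0` on the right vanishes because `μ₀(0) = 0`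
    rw [← Finset.add_sum_erase _ _ (Finset.mem_Iic.2 (zero_le (a := α)))] at h
    simp only [hmu0, Complex.ofReal_zero, mul_zero, zero_mul, zero_add] at h
    rw [hpsiD, ← inner_blochOp₀_eq_pair ha, cellRhs]
    simp only [hpsiD, funPair_toL2]
    simp only [← inner_blochOp₂_eq_pair ha, ← h]
    have h1 : ∑ j, (α j : ℂ) * inner ℂ W (blochOp₁ ha j (Ψ (α - unitIdx j)))
        = -(Complex.I * ∑ j, (α j : ℂ) *
          (funPair (fun y => flux a (toL2 (Ψ (α - unitIdx j))) y j) (toL2 W)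
          + divPair (fun y i => toL2 (Ψ (α - unitIdx j)) y * (a y i j : ℂ)) (toL2 W))) := by
      rw [Finset.mul_sum, ← Finset.sum_neg_distrib]
      refine Finset.sum_congr rfl fun j _ => ?_
      rw [inner_blochOp₁_eq_pair]
      ring
    rw [h1]
    ring
  have hodd : ∀ α : Fin n → ℕ, Odd (∑ i, α i) → muD a α = 0 := by
    intro α hα
    have h := multiDeriv_comp_neg α hμ
    simp only [blochMu_neg, hα.neg_one_pow, neg_smul, one_smul] at h
    rw [muD]
    linarith
  have hmuD := muD_eq_sum ha hψ hμ hψ0 he havg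
  have hΨ' : ∀ α, multiDeriv α ψ 0 = Ψ α := fun _ => rfl
  have hadd : ∀ {f g : (Fin n → ℝ) → ℂ}, Integrable f (volume.restrict (cell n)) →
      Integrable g (volume.restrict (cell n)) →
      Integrable (fun y => f y + g y) (volume.restrict (cell n)) := fun hf hg => hf.add hg
  have hI := fun α j => integrable_flux ha (Ψ α) j
  have hJ := fun α i j => integrable_coef_toL2 ha i j (Ψ α)
  refine ⟨hev.mp (hpsi.mono fun k h1 hk => ?_), hμ, hpsiA.congr hpsi.symm, hmu0, hone, hmean, hmem,
    ?_, hcell, ?_, hodd, ?_, isBigO_taylor_of_even hμ hμ0 hodd, ?_, ?_⟩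
  · rw [h1]
    exact ⟨hk.1, hk.2.1, hk.2.2.1⟩
  · intro α v hv
    obtain ⟨W, rfl⟩ := exists_toL2_eq hv
    simp only [hpsiD, formD_zero ha, formD_unitIdx ha, formD_unitIdx_add_unitIdx ha, funPair_toL2]
    rw [← hier α W]
    congr 1
    simp only [Finset.mul_sum]
    exact Finset.sum_congr rfl fun i _ => Finset.sum_congr rfl fun j _ => by ring
  · intro α hα w hw hw0
    obtain ⟨U, rfl⟩ := exists_toL2_eq hw.1
    -- the difference of two solutions has zero energy and zero average
    have h1 : blochOp₀ ha (U - Ψ α) = 0 := by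
      refine ext_inner_left ℂ fun W => ?_
      have h2 := hw.2 _ (toL2_mem_H1per W)
      have h3 := (hcell α).2 _ (toL2_mem_H1per W)
      rw [hpsiD, ← h2, ← inner_blochOp₀_eq_pair ha, ← inner_blochOp₀_eq_pair ha] at h3
      rw [map_sub, inner_sub_right, h3, sub_self, inner_zero_right]
    have h2 : U - Ψ α = 0 := by
      refine eq_zero_of_energy_eq_zero ha (by rw [h1, inner_zero_right]) ?_
      rw [map_sub, sobolevAverage_apply, average_eq_setAverage, hw0,
        cell_average_eq ψ hψ havg hα, sub_self]
    rw [sub_eq_zero.1 h2, hpsiD]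
  · intro α _ _
    rw [hmuD, sum_sum_multiIdx_eq α fun i j => by
      simp only [ha.symm _ i j, tsub_right_comm (a := α) (b := unitIdx i)]]
    simp only [hpsiD, hΨ, Finset.mul_sum]
    rw [add_comm, sub_eq_add_neg, ← Finset.sum_neg_distrib]
    congr 1
    exact Finset.sum_congr rfl fun j _ => by ring
  · intro i j
    have e1 : unitIdx i + unitIdx j - unitIdx i = unitIdx j := add_tsub_cancel_left _ _
    have e2 : unitIdx i + unitIdx j - unitIdx j = unitIdx i := add_tsub_cancel_right _ _
    -- `ψ₀^0` is the constant `1`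
    have hone' : ∀ p q, ⨍ y in cell n, (a y p q : ℂ) * toL2 (Ψ 0) y
        = ⨍ y in cell n, (a y p q : ℂ) := by
      intro p q
      rw [setAverage_cell, setAverage_cell]
      congr 1
      rw [← hpsiD]
      exact integral_congr_ae (hone.mono fun y hy => by simp only [hy, mul_one])
    have hA : Integrable (fun y => (a y i j : ℂ)) (volume.restrict (cell n)) :=
      (memLp_cell_of_continuous (ha.continuous i j)).integrable le_rfl
    rw [tensorA, Complex.ofReal_mul, hmuD]
    simp only [← Finset.mul_sum, Pi.add_apply, Nat.cast_add, add_mul, Finset.sum_add_distrib,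
      sum_unitIdx_mul, e1, e2, tsub_self, hpsiD, hΨ']
    rw [setAverage_sub hA ((hadd (hI _ _) (hI _ _)).const_mul _), setAverage_const_mul,
      setAverage_add (hI _ _) (hI _ _), hone', hone']
    simp only [ha.symm _ j i]
    push_cast
    ring
  · intro i j k l
    set α := unitIdx i + unitIdx j + unitIdx k + unitIdx l with hα
    have ei : α - unitIdx i = unitIdx j + unitIdx k + unitIdx l := by
      rw [hα, show unitIdx i + unitIdx j + unitIdx k + unitIdx l
        = unitIdx j + unitIdx k + unitIdx l + unitIdx i by abel, add_tsub_cancel_right]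
    have ej : α - unitIdx j = unitIdx i + unitIdx k + unitIdx l := by
      rw [hα, show unitIdx i + unitIdx j + unitIdx k + unitIdx l
        = unitIdx i + unitIdx k + unitIdx l + unitIdx j by abel, add_tsub_cancel_right]
    have ek : α - unitIdx k = unitIdx i + unitIdx j + unitIdx l := by
      rw [hα, show unitIdx i + unitIdx j + unitIdx k + unitIdx l
        = unitIdx i + unitIdx j + unitIdx l + unitIdx k by abel, add_tsub_cancel_right]
    have el : α - unitIdx l = unitIdx i + unitIdx j + unitIdx k := by
      rw [hα, add_tsub_cancel_right]
    have e1 : ∀ p q r : Fin n, unitIdx p + unitIdx q + unitIdx r - unitIdx p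
        = unitIdx q + unitIdx r := fun p q r => by rw [add_assoc, add_tsub_cancel_left]
    have e2 : ∀ p q r : Fin n, unitIdx p + unitIdx q + unitIdx r - unitIdx q
        = unitIdx p + unitIdx r := fun p q r => by
      rw [add_right_comm, add_tsub_cancel_right]
    have e3 : ∀ p q r : Fin n, unitIdx p + unitIdx q + unitIdx r - unitIdx r
        = unitIdx p + unitIdx q := fun p q r => add_tsub_cancel_right _ _
    have d4 : ∀ F : Fin n → ℂ, ∑ p, (α p : ℂ) * F p = F i + F j + F k + F l := fun F => by
      simp only [hα, Pi.add_apply, Nat.cast_add, add_mul, Finset.sum_add_distrib, sum_unitIdx_mul]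
    have d3 : ∀ (p q r : Fin n) (F : Fin n → ℂ),
        ∑ s, (((unitIdx p + unitIdx q + unitIdx r) s : ℕ) : ℂ) * F s = F p + F q + F r :=
      fun p q r F => by
        simp only [Pi.add_apply, Nat.cast_add, add_mul, Finset.sum_add_distrib, sum_unitIdx_mul]
    rw [tensorC, Complex.ofReal_mul, hmuD]
    simp only [← Finset.mul_sum, ← hα]
    rw [d4, d4]
    simp only [ei, ej, ek, el, d3, e1, e2, e3, hpsiD, hΨ']
    have hs2 := hadd (hJ (unitIdx k + unitIdx l) i j) (hJ (unitIdx j + unitIdx l) i k)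
    have hs3 := hadd hs2 (hJ (unitIdx j + unitIdx k) i l)
    have hs4 := hadd hs3 (hJ (unitIdx i + unitIdx l) j k)
    have hs5 := hadd hs4 (hJ (unitIdx i + unitIdx k) j l)
    have hs6 := hadd hs5 (hJ (unitIdx i + unitIdx j) k l)
    have hf2 := hadd (hI (unitIdx j + unitIdx k + unitIdx l) i)
      (hI (unitIdx i + unitIdx k + unitIdx l) j)
    have hf3 := hadd hf2 (hI (unitIdx i + unitIdx j + unitIdx l) k)
    have hf4 := hadd hf3 (hI (unitIdx i + unitIdx j + unitIdx k) l)
    rw [setAverage_sub (hs6.const_mul 2) (hf4.const_mul Complex.I), setAverage_const_mul,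
      setAverage_const_mul, setAverage_add hs5 (hJ _ _ _), setAverage_add hs4 (hJ _ _ _),
      setAverage_add hs3 (hJ _ _ _), setAverage_add hs2 (hJ _ _ _),
      setAverage_add (hJ _ _ _) (hJ _ _ _), setAverage_add hf3 (hI _ _),
      setAverage_add hf2 (hI _ _), setAverage_add (hI _ _) (hI _ _)]
    simp only [ha.symm _ j i, ha.symm _ k i, ha.symm _ l i, ha.symm _ k j, ha.symm _ l j,
      ha.symm _ l k]
    push_cast
    ring
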